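/- Let $p$ be a prime and let $(R,\mathfrak m)$ be a Noetherian local ring of characteristic $p$ and dimension $d$. For each $i$ let $0^F_{H^i_{\mathfrak m}(R)}$ be the submodule of $H^i_{\mathfrak m}(R)$ consisting of the classes killed by all sufficiently high iterates of the natural Frobenius action on local cohomology. The ring $R$ is called weakly $F$-nilpotent if $0^F_{H^i_{\mathfrak m}(R)}=H^i_{\mathfrak m}(R)$ for all $0\le i<d$; generalized weakly $F$-nilpotent if $H^i_{\mathfrak m}(R)/0^F_{H^i_{\mathfrak m}(R)}$ has finite length for all $0\le i<d$; and generalized Cohen–Macaulay if $H^i_{\mathfrak m}(R)$ has finite length for all $0\le i<d$. Let $K$ be a perfect field of characteristic $p$, and let $(A,\mathfrak m,k)$ be a local domain essentially of finite type over $K$, of dimension $2$ and depth $1$, which is weakly $F$-nilpotent. Glue the closed points $(\mathfrak m,T)$ and $(\mathfrak m,T-1)$ of $\operatorname{Spec} A[T]$, that is, put $$R'=\{f\in A[T] : f(0)\equiv f(1) \bmod \mathfrak m\},\qquad A\subset R'\subset A[T],$$ and let $\mathfrak c=\operatorname{Ann}_{R'}(A[T]/R')$. Then $\mathfrak c$ is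 a maximal ideal of $R'$. Put $R=R'_{\mathfrak c}$ and $B=A[T]_{\mathfrak n}$ with $\mathfrak n=(\mathfrak m,T)$. The natural map $A\to R$ is an injective local homomorphism, and there is an injective local homomorphism of $R'$-algebras $R\to B$. Moreover, $R$ is a Noetherian local ring which is generalized weakly $F$-nilpotent, but is neither generalized Cohen–Macaulay nor weakly $F$-nilpotent. -/

import Mathlib

open CategoryTheory IsLocalRing
open scoped Polynomial

universe u

noncomputable section

/-! ### Depth, local cohomology and its Frobenius action -/

/-- The depth of a local ring: the supremum of the lengths of the regular sequences
contained in the maximal ideal. -/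
def localDepth (R : Type u) [CommRing R] [IsLocalRing R] : ℕ∞ :=
  ⨆ (rs : List R) (_ : RingTheory.Sequence.IsRegular R rs)
    (_ : ∀ r ∈ rs, r ∈ maximalIdeal R), (rs.length : ℕ∞)

/-- The local cohomology module `H^i_𝔪(R)` of a local ring `R`. -/
abbrev localCohomologyMax (R : Type u) [CommRing R] [IsLocalRing R] (i : ℕ) : ModuleCat.{u} R :=
  (localCohomology (maximalIdeal R) i).obj (ModuleCat.of R R)

/-- The Frobenius pushforward `F^e_* R`: the ring `R`, viewed as an `R`-module through the
`e`-th iterate of the Frobenius endomorphism. -/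
abbrev frobeniusPushforward (R : Type u) [CommRing R] (p : ℕ) [Fact p.Prime] [CharP R p]
    (e : ℕ) : ModuleCat.{u} R :=
  (ModuleCat.restrictScalars (iterateFrobenius R p e)).obj (ModuleCat.of R R)

/-- The `e`-th iterate of Frobenius, `r ↦ r ^ (p ^ e)`, as an `R`-linear map `R → F^e_* R`. -/
def frobeniusToPushforward (R : Type u) [CommRing R] (p : ℕ) [Fact p.Prime] [CharP R p]
    (e : ℕ) : ModuleCat.of R R ⟶ frobeniusPushforward R p e :=
  ModuleCat.ofHom (Y := frobeniusPushforward R p e)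
    { toFun := fun r => iterateFrobenius R p e r
      map_add' := fun a b => map_add (iterateFrobenius R p e) a b
      map_smul' := fun a b => map_mul (iterateFrobenius R p e) a b }

/-- The `e`-th Frobenius action on `H^i_𝔪(R)`, as the `R`-linear map
`H^i_𝔪(R) → H^i_𝔪(F^e_* R)` induced by `F^e : R → F^e_* R`.  (By independence of base,
the target is `F^e_* H^i_𝔪(R)`, because `𝔪` and its Frobenius powers have the same radical.) -/
def frobeniusAction (R : Type u) [CommRing R] [IsLocalRing R] (p : ℕ) [Fact p.Prime] [CharP R p]
    (i e : ℕ) : localCohomologyMax R i ⟶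
      (localCohomology (maximalIdeal R) i).obj (frobeniusPushforward R p e) :=
  (localCohomology (maximalIdeal R) i).map (frobeniusToPushforward R p e)

/-- The submodule `0^F` of `H^i_𝔪(R)`: the classes killed by all sufficiently high iterates of
the Frobenius action. -/
def frobeniusNilpotentPart (R : Type u) [CommRing R] [IsLocalRing R] (p : ℕ) [Fact p.Prime]
    [CharP R p] (i : ℕ) : Submodule R (localCohomologyMax R i) where
  carrier := {η | ∀ᶠ e in Filter.atTop, (frobeniusAction R p i e).hom η = 0}
  add_mem' := by
    intro a b ha hb
    filter_upwards [ha, hb] with e h1 h2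
    rw [map_add, h1, h2, add_zero]
  zero_mem' := Filter.Eventually.of_forall fun e => map_zero _
  smul_mem' := by
    intro r a ha
    filter_upwards [ha] with e h1
    rw [map_smul, h1, smul_zero]

/-! ### The singularity classes -/

/-- `R` is weakly `F`-nilpotent: `0^F = H^i_𝔪(R)` for all `0 ≤ i < dim R`. -/
def IsWeaklyFNilpotent (R : Type u) [CommRing R] [IsLocalRing R] (p : ℕ) [Fact p.Prime]
    [CharP R p] : Prop :=
  ∀ i : ℕ, (i : WithBot ℕ∞) < ringKrullDim R → frobeniusNilpotentPart R p i = ⊤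

/-- `R` is generalized weakly `F`-nilpotent: `H^i_𝔪(R) / 0^F` has finite length for all
`0 ≤ i < dim R`. -/
def IsGeneralizedWeaklyFNilpotent (R : Type u) [CommRing R] [IsLocalRing R] (p : ℕ)
    [Fact p.Prime] [CharP R p] : Prop :=
  ∀ i : ℕ, (i : WithBot ℕ∞) < ringKrullDim R →
    IsFiniteLength R (localCohomologyMax R i ⧸ frobeniusNilpotentPart R p i)

/-- `R` is generalized Cohen–Macaulay: `H^i_𝔪(R)` has finite length for all `0 ≤ i < dim R`. -/
def IsGeneralizedCohenMacaulay (R : Type u) [CommRing R] [IsLocalRing R] : Prop :=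
  ∀ i : ℕ, (i : WithBot ℕ∞) < ringKrullDim R → IsFiniteLength R (localCohomologyMax R i)

/-! ### Gluing the closed points `T = 0` and `T = 1` of `A[T]` -/

/-- Evaluation of `f ∈ A[T]` at `T = a`, followed by reduction to the residue field of `A`. -/
def evalResidue (A : Type u) [CommRing A] [IsLocalRing A] (a : A) : A[X] →+* ResidueField A :=
  (residue A).comp (Polynomial.evalRingHom a)

/-- The subring `R'` of those `f ∈ A[T]` whose values at the closed points `(𝔪, T)` and
`(𝔪, T - 1)` agree in the residue field of `A`.  It contains `A`. -/
def gluedSubalgebra (A : Type u) [CommRing A] [IsLocalRing A] : Subalgebra A A[X] where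
  __ := RingHom.eqLocus (evalResidue A 0) (evalResidue A 1)
  algebraMap_mem' a := by
    change evalResidue A 0 _ = evalResidue A 1 _
    simp [evalResidue]

/-- The conductor `𝔠 = Ann_{R'}(A[T] / R')`. -/
def gluedConductor (A : Type u) [CommRing A] [IsLocalRing A] : Ideal (gluedSubalgebra A) :=
  Module.annihilator (gluedSubalgebra A)
    (A[X] ⧸ LinearMap.range (Algebra.linearMap (gluedSubalgebra A) A[X]))

/-- The maximal ideal `𝔫 = (𝔪, T)` of `A[T]`. -/
def originIdeal (A : Type u) [CommRing A] [IsLocalRing A] : Ideal A[X] :=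
  (maximalIdeal A).map Polynomial.C ⊔ Ideal.span {Polynomial.X}

theorem originIdeal_eq_ker (A : Type u) [CommRing A] [IsLocalRing A] :
    originIdeal A = RingHom.ker (evalResidue A 0) := by
  apply le_antisymm
  · refine sup_le (Ideal.map_le_iff_le_comap.2 fun a ha => ?_) ?_
    · simpa [evalResidue, RingHom.mem_ker] using ha
    · rw [Ideal.span_singleton_le_iff_mem]
      simp [evalResidue, RingHom.mem_ker]
  · intro f hf
    have h0 : f.coeff 0 ∈ maximalIdeal A := by
      simpa [evalResidue, RingHom.mem_ker, Polynomial.coeff_zero_eq_eval_zero] using hf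
    rw [← Polynomial.divX_mul_X_add f]
    exact add_mem (Ideal.mul_mem_left _ _ (Ideal.mem_sup_right (Ideal.mem_span_singleton_self _)))
      (Ideal.mem_sup_left (Ideal.mem_map_of_mem _ h0))

instance originIdeal_isPrime (A : Type u) [CommRing A] [IsLocalRing A] :
    (originIdeal A).IsPrime := by
  rw [originIdeal_eq_ker]
  exact RingHom.ker_isPrime _

/-! ### Characteristic -/

instance gluedSubalgebra_charP (A : Type u) [CommRing A] [IsLocalRing A] (p : ℕ) [CharP A p] :
    CharP (gluedSubalgebra A) p :=
  (gluedSubalgebra A).val.toRingHom.charP Subtype.val_injective p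

instance localizationAtPrime_charP (R : Type u) [CommRing R] [IsDomain R] (P : Ideal R)
    [P.IsPrime] (p : ℕ) [CharP R p] : CharP (Localization.AtPrime P) p :=
  charP_of_injective_algebraMap
    (IsLocalization.injective (Localization.AtPrime P) P.primeCompl_le_nonZeroDivisors) p

end

/-!
The local cohomology of `R` is computed inside the field `E = Frac A[T]`. Write `t = T (T - 1)`, and
call a polynomial a unit at the glued point if its values at `0` and `1` are units of `A`.

Local cohomology is a colimit of `Ext` modules, so its classes are represented by cocycles on
projective resolutions of `R ⧸ 𝔪 ^ n` (`LocalCohomologyClass.exists_classOf_eq`,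
`LocalCohomologyClass.classOf_eq_zero_iff`). Lifting cocycles gives the connecting homomorphism
(`connecting`), its naturality and the long exact sequence; `H^0_𝔪` is the `𝔪`-power torsion
(`ofPowTorsion_bijective`). Modules on which an element of `𝔪` acts bijectively have no local
cohomology, and `H^1_𝔪` vanishes on modules killed by `𝔪`.

As `E` has no local cohomology, `H^{i+1}_𝔪(R)` is `H^i_𝔪(E ⧸ R)`, and Frobenius on it is induced by
`x ↦ x ^ q` on `E` (`frobeniusAction_baseConnecting_eq_zero_iff`). In degree one this gives the
`𝔪`-power torsion of `E ⧸ R`, which is generated by the class of `T`, an element killed by `𝔪`. So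
`H^1_𝔪(R)` has finite length; but no positive power of `T` is in `R`, as `T` separates the glued
points, and `R` is not weakly `F`-nilpotent.

For degree two let `P` be the fractions with denominators `a g` and `Q` those with denominators
`t ^ n g`, where `a ∈ A` is nonzero and `g` is a unit at the glued point. The intersection `P ∩ Q`
is the semilocalization of `A[T]` at the two points, and `𝔪` multiplies it into `R`. Some element of
`𝔪` acts bijectively on `E ⧸ P`, and another on `E ⧸ Q`, so that the Mayer–Vietoris sequence
`0 → E ⧸ (P ∩ Q) → E ⧸ P × E ⧸ Q → E ⧸ (P + Q) → 0` identifies `H^1_𝔪(E ⧸ (P ∩ Q))` with the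
`𝔪`-power torsion of `E ⧸ (P + Q)`. The map `H^2_𝔪(R) = H^1_𝔪(E ⧸ R) → H^1_𝔪(E ⧸ (P ∩ Q))` is
injective, and its cokernel is killed by `𝔪`, because `(P ∩ Q) ⧸ R` is
(`frobeniusNilpotentPart_two_eq_top`, `not_isFiniteLength_two`).

Every torsion element of `E ⧸ (P + Q)` is represented by some `h / (a t ^ N)` with
`deg h < 2 N` (`GluedPoints.exists_normal_form`), and such an element vanishes only if `a ∣ h`
(`GluedPoints.C_dvd_of_mem_sup`). Hence its coefficients give torsion elements of
`Frac A ⧸ A`, that is, classes in `H^1(A)`. These are `F`-nilpotent by hypothesis, so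
`H^2_𝔪(R)` is `F`-nilpotent (`GluedPoints.eventually_pow_mem_sup`). As `A` has depth one, there is a
socle element `c / a` of `Frac A ⧸ A`. The elements `w_j = c / (a t ^ (j + 1))` are torsion in
`E ⧸ (P + Q)`, with `t w_{j+1} = w_j` and `w_0 ≠ 0`, so `H^2_𝔪(R)` does not have finite length
(`GluedPoints.smul_mem_sup_of_socle`).

Finally `A[T]` is a finite module over the glued ring, generated by `1` and `T`, so that the glued
ring is Noetherian by the Artin–Tate lemma, and `dim R = dim A + 1 = 3` by going up and
incomparability.
-/

noncomputable section

/-! ### The cohomology of `Hom(P, Y)` through cocycles -/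

namespace ExtCocycle
open Limits Opposite

variable {R : Type u} [CommRing R]

/-- The complex `Hom(P, Y)`, viewed as a chain complex in the opposite category. -/
abbrev homComplex (P : ChainComplex (ModuleCat.{u} R) ℕ) (Y : ModuleCat.{u} R) :
    ChainComplex (ModuleCat.{u} R)ᵒᵖ ℕ :=
  (((linearYoneda R (ModuleCat.{u} R)).obj Y).rightOp.mapHomologicalComplex _).obj P

/-- The `n`-cocycles of the complex `Hom(P, Y)`. -/
def cocycles (P : ChainComplex (ModuleCat.{u} R) ℕ) (n : ℕ) (Y : ModuleCat.{u} R) :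
    Submodule R (P.X n ⟶ Y) :=
  LinearMap.ker (Linear.leftComp R Y (P.d (n + 1) n))

theorem mem_cocycles {P : ChainComplex (ModuleCat.{u} R) ℕ} {n : ℕ} {Y : ModuleCat.{u} R}
    {f : P.X n ⟶ Y} : f ∈ cocycles P n Y ↔ P.d (n + 1) n ≫ f = 0 := Iff.rfl

/-- The inclusion of the cocycles, in the opposite category. -/
def toCocycles (P : ChainComplex (ModuleCat.{u} R) ℕ) (n : ℕ) (Y : ModuleCat.{u} R) :
    (homComplex P Y).X n ⟶ op (ModuleCat.of R (cocycles P n Y)) :=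
  (ModuleCat.ofHom (cocycles P n Y).subtype).op

theorem d_toCocycles (P : ChainComplex (ModuleCat.{u} R) ℕ) (n : ℕ) (Y : ModuleCat.{u} R) :
    (homComplex P Y).d (n + 1) n ≫ toCocycles P n Y = 0 := by
  apply Quiver.Hom.unop_inj
  ext z
  exact z.2

/-- The comparison between the cocycles and the opcycles of `homComplex P Y`, which are the
cocycles in the opposite category. -/
def opcyclesDesc (P : ChainComplex (ModuleCat.{u} R) ℕ) (n : ℕ) (Y : ModuleCat.{u} R) :
    (homComplex P Y).opcycles n ⟶ op (ModuleCat.of R (cocycles P n Y)) :=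
  (homComplex P Y).descOpcycles (toCocycles P n Y) (n + 1) (by simp) (d_toCocycles P n Y)

/-- The cohomology class of a cocycle of `Hom(P, Y)`. -/
def toHomology (P : ChainComplex (ModuleCat.{u} R) ℕ) (n : ℕ) (Y : ModuleCat.{u} R) :
    ModuleCat.of R (cocycles P n Y) ⟶ ((homComplex P Y).homology n).unop :=
  ((homComplex P Y).homologyι n ≫ opcyclesDesc P n Y).unop

theorem pOpcycles_unop_injective (P : ChainComplex (ModuleCat.{u} R) ℕ) (n : ℕ)
    (Y : ModuleCat.{u} R) :
    Function.Injective ((homComplex P Y).pOpcycles n).unop.hom :=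
  (ModuleCat.mono_iff_injective _).1 inferInstance

theorem pOpcycles_unop_opcyclesDesc (P : ChainComplex (ModuleCat.{u} R) ℕ) (n : ℕ)
    (Y : ModuleCat.{u} R) (z : cocycles P n Y) :
    ((homComplex P Y).pOpcycles n).unop.hom ((opcyclesDesc P n Y).unop.hom z) =
      (z : P.X n ⟶ Y) := by
  have h : (homComplex P Y).pOpcycles n ≫ opcyclesDesc P n Y = toCocycles P n Y := by
    simp [opcyclesDesc]
  exact congr($(congrArg Quiver.Hom.unop h).hom z)

theorem opcyclesDesc_unop_surjective (P : ChainComplex (ModuleCat.{u} R) ℕ) (n : ℕ)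
    (Y : ModuleCat.{u} R) : Function.Surjective (opcyclesDesc P n Y).unop.hom := by
  intro x
  have h : (homComplex P Y).d (n + 1) n ≫ (homComplex P Y).pOpcycles n = 0 :=
    (homComplex P Y).d_pOpcycles (n + 1) n
  have h' := congr($(congrArg Quiver.Hom.unop h).hom x)
  refine ⟨⟨((homComplex P Y).pOpcycles n).unop.hom x, h'⟩, ?_⟩
  apply pOpcycles_unop_injective
  rw [pOpcycles_unop_opcyclesDesc]

theorem toHomology_surjective (P : ChainComplex (ModuleCat.{u} R) ℕ) (n : ℕ)
    (Y : ModuleCat.{u} R) : Function.Surjective (toHomology P n Y).hom := by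
  have h : Function.Surjective ((homComplex P Y).homologyι n).unop.hom :=
    (ModuleCat.epi_iff_surjective _).1 inferInstance
  exact h.comp (opcyclesDesc_unop_surjective P n Y)

theorem toHomology_eq_zero_iff (P : ChainComplex (ModuleCat.{u} R) ℕ) (n : ℕ)
    (Y : ModuleCat.{u} R) (z : cocycles P n Y) :
    (toHomology P n Y).hom z = 0 ↔ ∃ (j : ℕ) (g : P.X j ⟶ Y), P.d n j ≫ g = z := by
  set K := homComplex P Y
  constructor
  · intro hz
    let S : ShortComplex (ModuleCat.{u} R)ᵒᵖ := ShortComplex.mk (K.homologyι n)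
      (K.fromOpcycles n ((ComplexShape.down ℕ).next n)) (by simp)
    have hS : S.Exact := S.exact_of_f_is_kernel (K.homologyIsKernel n _ rfl)
    obtain ⟨g, hg⟩ := (ShortComplex.moduleCat_exact_iff _).1 hS.unop
      ((opcyclesDesc P n Y).unop.hom z) hz
    refine ⟨_, g, ?_⟩
    rw [← pOpcycles_unop_opcyclesDesc, ← hg]
    have h : K.pOpcycles n ≫ K.fromOpcycles n ((ComplexShape.down ℕ).next n) = K.d n _ := by simp
    exact congr($(congrArg Quiver.Hom.unop h.symm).hom g)
  · rintro ⟨j, g, hg⟩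
    by_cases hj : (ComplexShape.down ℕ).Rel n j
    · have h : (opcyclesDesc P n Y).unop.hom z = (K.fromOpcycles n j).unop.hom g := by
        apply pOpcycles_unop_injective
        rw [pOpcycles_unop_opcyclesDesc, ← hg]
        have h : K.pOpcycles n ≫ K.fromOpcycles n j = K.d n _ := by simp
        exact congr($(congrArg Quiver.Hom.unop h.symm).hom g)
      change (K.homologyι n).unop.hom ((opcyclesDesc P n Y).unop.hom z) = 0
      rw [h]
      have h' : K.homologyι n ≫ K.fromOpcycles n j = 0 := by simp
      exact congr($(congrArg Quiver.Hom.unop h').hom g)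
    · have : z = 0 := by
        apply Subtype.ext
        rw [← hg, P.shape _ _ hj]
        simp
      rw [this, map_zero]

/-- Precomposition of cocycles with a chain map. -/
def cocyclesPre {P Q : ChainComplex (ModuleCat.{u} R) ℕ} (φ : P ⟶ Q) (n : ℕ)
    (Y : ModuleCat.{u} R) : cocycles Q n Y →ₗ[R] cocycles P n Y :=
  (Linear.leftComp R Y (φ.f n)).restrict fun f hf => by
    rw [mem_cocycles] at hf ⊢
    simp [← φ.comm_assoc, hf]

/-- Postcomposition of cocycles with a linear map. -/
def cocyclesPost (P : ChainComplex (ModuleCat.{u} R) ℕ) (n : ℕ)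
    {Y Z : ModuleCat.{u} R} (g : Y ⟶ Z) : cocycles P n Y →ₗ[R] cocycles P n Z :=
  (Linear.rightComp R (P.X n) g).restrict fun f hf => by
    rw [mem_cocycles] at hf ⊢
    simp [reassoc_of% hf]

@[simp] theorem cocyclesPre_coe {P Q : ChainComplex (ModuleCat.{u} R) ℕ} (φ : P ⟶ Q) (n : ℕ)
    (Y : ModuleCat.{u} R) (z : cocycles Q n Y) :
    (cocyclesPre φ n Y z : P.X n ⟶ Y) = φ.f n ≫ z := rfl

@[simp] theorem cocyclesPost_coe (P : ChainComplex (ModuleCat.{u} R) ℕ) (n : ℕ)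
    {Y Z : ModuleCat.{u} R} (g : Y ⟶ Z) (z : cocycles P n Y) :
    (cocyclesPost P n g z : P.X n ⟶ Z) = z ≫ g := rfl

theorem toHomology_pre {P Q : ChainComplex (ModuleCat.{u} R) ℕ} (φ : P ⟶ Q) (n : ℕ)
    (Y : ModuleCat.{u} R) :
    toHomology Q n Y ≫ (HomologicalComplex.homologyMap
      ((((linearYoneda R (ModuleCat.{u} R)).obj Y).rightOp.mapHomologicalComplex _).map φ) n).unop
      = ModuleCat.ofHom (cocyclesPre φ n Y) ≫ toHomology P n Y := by
  apply Quiver.Hom.op_inj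
  simp only [toHomology, op_comp, Quiver.Hom.op_unop, HomologicalComplex.homologyι_naturality_assoc,
    Category.assoc]
  congr 1
  rw [← cancel_epi (HomologicalComplex.pOpcycles _ _)]
  simp [opcyclesDesc]
  apply Quiver.Hom.unop_inj
  rfl

theorem toHomology_post (P : ChainComplex (ModuleCat.{u} R) ℕ) (n : ℕ)
    {Y Z : ModuleCat.{u} R} (g : Y ⟶ Z) :
    toHomology P n Y ≫ (HomologicalComplex.homologyMap
      ((NatTrans.mapHomologicalComplex
        (NatTrans.rightOp ((linearYoneda R (ModuleCat.{u} R)).map g)) _).app P) n).unop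
      = ModuleCat.ofHom (cocyclesPost P n g) ≫ toHomology P n Z := by
  apply Quiver.Hom.op_inj
  simp only [toHomology, op_comp, Quiver.Hom.op_unop, HomologicalComplex.homologyι_naturality_assoc,
    Category.assoc]
  congr 1
  rw [← cancel_epi (HomologicalComplex.pOpcycles _ _)]
  simp [opcyclesDesc]
  apply Quiver.Hom.unop_inj
  rfl

/-! ### Ext groups of modules through cocycles -/

/-- The comparison between the cohomology of `Hom(P, Y)` and `Ext^n(X, Y)`. -/
def homologyToExt {X : ModuleCat.{u} R} (P : ProjectiveResolution X) (n : ℕ)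
    (Y : ModuleCat.{u} R) : ((homComplex P.complex Y).homology n).unop ⟶
      ((Ext R (ModuleCat.{u} R) n).obj (op X)).obj Y :=
  (P.isoLeftDerivedObj ((linearYoneda R (ModuleCat.{u} R)).obj Y).rightOp n).hom.unop

theorem homologyToExt_bijective {X : ModuleCat.{u} R} (P : ProjectiveResolution X) (n : ℕ)
    (Y : ModuleCat.{u} R) : Function.Bijective (homologyToExt P n Y).hom := by
  have : IsIso (homologyToExt P n Y) := isIso_unop _
  exact (ConcreteCategory.isIso_iff_bijective _).1 this

theorem homologyToExt_pre {X X' : ModuleCat.{u} R} (P : ProjectiveResolution X)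
    (P' : ProjectiveResolution X') (f : X' ⟶ X) (φ : P'.complex ⟶ P.complex)
    (comm : φ.f 0 ≫ P.π.f 0 = P'.π.f 0 ≫ f) (n : ℕ) (Y : ModuleCat.{u} R) :
    homologyToExt P n Y ≫ ((Ext R (ModuleCat.{u} R) n).map f.op).app Y =
      (HomologicalComplex.homologyMap
      ((((linearYoneda R (ModuleCat.{u} R)).obj Y).rightOp.mapHomologicalComplex _).map φ) n).unop
      ≫ homologyToExt P' n Y :=
  congrArg Quiver.Hom.unop (ProjectiveResolution.isoLeftDerivedObj_hom_naturality f P' P φ comm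
    ((linearYoneda R (ModuleCat.{u} R)).obj Y).rightOp n)

theorem homologyToExt_post {X : ModuleCat.{u} R} (P : ProjectiveResolution X) (n : ℕ)
    {Y Z : ModuleCat.{u} R} (g : Y ⟶ Z) :
    homologyToExt P n Y ≫ ((Ext R (ModuleCat.{u} R) n).obj (op X)).map g =
      (HomologicalComplex.homologyMap
      ((NatTrans.mapHomologicalComplex
        (NatTrans.rightOp ((linearYoneda R (ModuleCat.{u} R)).map g)) _).app P.complex) n).unop
      ≫ homologyToExt P n Z := by
  have h : (NatTrans.leftDerived
        (NatTrans.rightOp ((linearYoneda R (ModuleCat.{u} R)).map g)) n).app X ≫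
      (P.isoLeftDerivedObj ((linearYoneda R (ModuleCat.{u} R)).obj Y).rightOp n).hom =
      (P.isoLeftDerivedObj ((linearYoneda R (ModuleCat.{u} R)).obj Z).rightOp n).hom ≫
      HomologicalComplex.homologyMap
      ((NatTrans.mapHomologicalComplex
        (NatTrans.rightOp ((linearYoneda R (ModuleCat.{u} R)).map g)) _).app P.complex) n := by
    exact (Iso.eq_comp_inv _).1
      ((ProjectiveResolution.leftDerived_app_eq _ P n).trans (Category.assoc _ _ _).symm)
  exact congrArg Quiver.Hom.unop h

/-- The class in `Ext^n(X, Y)` of a cocycle of `Hom(P, Y)`, for a projective resolution `P`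
of `X`. -/
def extClass {X : ModuleCat.{u} R} (P : ProjectiveResolution X) (n : ℕ) (Y : ModuleCat.{u} R) :
    ModuleCat.of R (cocycles P.complex n Y) ⟶
      ((Ext R (ModuleCat.{u} R) n).obj (op X)).obj Y :=
  toHomology P.complex n Y ≫ homologyToExt P n Y

theorem extClass_surjective {X : ModuleCat.{u} R} (P : ProjectiveResolution X) (n : ℕ)
    (Y : ModuleCat.{u} R) : Function.Surjective (extClass P n Y).hom :=
  (homologyToExt_bijective P n Y).2.comp (toHomology_surjective _ _ _)

theorem extClass_eq_zero_iff {X : ModuleCat.{u} R} (P : ProjectiveResolution X) (n : ℕ)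
    (Y : ModuleCat.{u} R) (z : cocycles P.complex n Y) :
    (extClass P n Y).hom z = 0 ↔ ∃ (j : ℕ) (g : P.complex.X j ⟶ Y), P.complex.d n j ≫ g = z := by
  rw [← toHomology_eq_zero_iff]
  exact map_eq_zero_iff (homologyToExt P n Y).hom (homologyToExt_bijective P n Y).1

theorem extClass_pre {X X' : ModuleCat.{u} R} (P : ProjectiveResolution X)
    (P' : ProjectiveResolution X') (f : X' ⟶ X) (φ : P'.complex ⟶ P.complex)
    (comm : φ.f 0 ≫ P.π.f 0 = P'.π.f 0 ≫ f) (n : ℕ) (Y : ModuleCat.{u} R) :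
    extClass P n Y ≫ ((Ext R (ModuleCat.{u} R) n).map f.op).app Y =
      ModuleCat.ofHom (cocyclesPre φ n Y) ≫ extClass P' n Y := by
  rw [extClass, extClass, Category.assoc, homologyToExt_pre P P' f φ comm, ← Category.assoc,
    ← Category.assoc, toHomology_pre]

theorem extClass_post {X : ModuleCat.{u} R} (P : ProjectiveResolution X) (n : ℕ)
    {Y Z : ModuleCat.{u} R} (g : Y ⟶ Z) :
    extClass P n Y ≫ ((Ext R (ModuleCat.{u} R) n).obj (op X)).map g =
      ModuleCat.ofHom (cocyclesPost P.complex n g) ≫ extClass P n Z := by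
  rw [extClass, extClass, Category.assoc, homologyToExt_post P n g, ← Category.assoc,
    ← Category.assoc, toHomology_post]

end ExtCocycle

/-! ### Local cohomology classes through cocycles -/

namespace LocalCohomologyClass
open Limits Opposite ExtCocycle

variable {R : Type u} [CommRing R] (J : Ideal R)

/-- The chosen projective resolution of `R ⧸ J ^ m`. -/
abbrev res (m : ℕ) : ProjectiveResolution (ModuleCat.of R (R ⧸ J ^ m)) :=
  projectiveResolution _

/-- The structure map from `Ext^i(R ⧸ J ^ m, -)` to `H^i_J`. -/
def ofExt (i m : ℕ) : (Ext R (ModuleCat.{u} R) i).obj (op (ModuleCat.of R (R ⧸ J ^ m))) ⟶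
    localCohomology J i :=
  colimit.ι (localCohomology.diagram (localCohomology.idealPowersDiagram J) i) (op (op m))

/-- The transition map `R ⧸ J ^ m' → R ⧸ J ^ m`. -/
abbrev factorHom {m m' : ℕ} (hm : m ≤ m') :
    ModuleCat.of R (R ⧸ J ^ m') ⟶ ModuleCat.of R (R ⧸ J ^ m) :=
  ModuleCat.ofHom (Submodule.factor (Ideal.pow_le_pow_right hm))

theorem map_ofExt (i : ℕ) {m m' : ℕ} (hm : m ≤ m') :
    (Ext R (ModuleCat.{u} R) i).map (factorHom J hm).op ≫ ofExt J i m' = ofExt J i m :=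
  colimit.w (localCohomology.diagram (localCohomology.idealPowersDiagram J) i)
    (homOfLE hm).op.op

theorem exists_ofExt_eq (i : ℕ) {M : ModuleCat.{u} R} (ξ : (localCohomology J i).obj M) :
    ∃ (m : ℕ) (x : ((Ext R (ModuleCat.{u} R) i).obj (op (ModuleCat.of R (R ⧸ J ^ m)))).obj M),
      ((ofExt J i m).app M).hom x = ξ := by
  let D := localCohomology.diagram (localCohomology.idealPowersDiagram J) i
  have : PreservesFilteredColimitsOfSize.{0, 0} (forget (ModuleCat.{u} R)) :=
    preservesFilteredColimitsOfSize_shrink.{0, u, 0, u} _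
  have hc := isColimitOfPreserves ((evaluation _ _).obj M) (colimit.isColimit D)
  obtain ⟨m, x, hx⟩ := Concrete.isColimit_exists_rep _ hc ξ
  exact ⟨m.unop.unop, x, hx⟩

theorem exists_of_ofExt_eq_zero (i m : ℕ) {M : ModuleCat.{u} R}
    (x : ((Ext R (ModuleCat.{u} R) i).obj (op (ModuleCat.of R (R ⧸ J ^ m)))).obj M)
    (hx : ((ofExt J i m).app M).hom x = 0) :
    ∃ (m' : ℕ) (hm : m ≤ m'),
      (((Ext R (ModuleCat.{u} R) i).map (factorHom J hm).op).app M).hom x = 0 := by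
  let D := localCohomology.diagram (localCohomology.idealPowersDiagram J) i
  have : PreservesFilteredColimitsOfSize.{0, 0} (forget (ModuleCat.{u} R)) :=
    preservesFilteredColimitsOfSize_shrink.{0, u, 0, u} _
  have hc := isColimitOfPreserves ((evaluation _ _).obj M) (colimit.isColimit D)
  obtain ⟨k, f, g, h⟩ := Concrete.isColimit_exists_of_rep_eq _ hc (i := op (op m))
    (j := op (op m)) x 0 (hx.trans (map_zero _).symm)
  refine ⟨k.unop.unop, leOfHom f.unop.unop, ?_⟩
  rw [map_zero] at h
  exact h

/-- The class in `H^i_J(M)` of a cocycle of `Hom(P, M)`, where `P` is the chosen projective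
resolution of `R ⧸ J ^ m`. -/
def classOf (i m : ℕ) (M : ModuleCat.{u} R) :
    cocycles (res J m).complex i M →ₗ[R] (localCohomology J i).obj M :=
  (extClass (res J m) i M ≫ (ofExt J i m).app M).hom

theorem classOf_post (i m : ℕ) {M N : ModuleCat.{u} R} (g : M ⟶ N)
    (z : cocycles (res J m).complex i M) :
    ((localCohomology J i).map g).hom (classOf J i m M z) =
      classOf J i m N (cocyclesPost _ i g z) := by
  have h : (extClass (res J m) i M ≫ (ofExt J i m).app M) ≫ (localCohomology J i).map g =
      ModuleCat.ofHom (cocyclesPost _ i g) ≫ extClass (res J m) i N ≫ (ofExt J i m).app N := by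
    rw [Category.assoc, ← (ofExt J i m).naturality, ← Category.assoc, extClass_post,
      Category.assoc]
  exact congr($(h).hom z)

/-- A chain map between the chosen resolutions that lifts the transition map
`R ⧸ J ^ m' → R ⧸ J ^ m`. -/
structure Transition (m m' : ℕ) where
  le : m ≤ m'
  hom : (res J m').complex ⟶ (res J m).complex
  comm : hom.f 0 ≫ (res J m).π.f 0 = (res J m').π.f 0 ≫ factorHom J le

theorem exists_transition {m m' : ℕ} (h : m ≤ m') : Nonempty (Transition J m m') :=
  ⟨h, ProjectiveResolution.lift (factorHom J h) (res J m') (res J m),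
    ProjectiveResolution.lift_commutes_zero _ _ _⟩

variable {J}

theorem classOf_pre (i : ℕ) {m m' : ℕ} (φ : Transition J m m') (M : ModuleCat.{u} R)
    (z : cocycles (res J m).complex i M) :
    classOf J i m' M (cocyclesPre φ.hom i M z) = classOf J i m M z := by
  have h := extClass_pre (res J m) (res J m') (factorHom J φ.le) φ.hom φ.comm i M
  have h2 : ModuleCat.ofHom (cocyclesPre φ.hom i M) ≫ extClass (res J m') i M ≫
      (ofExt J i m').app M = extClass (res J m) i M ≫ (ofExt J i m).app M := by
    rw [← map_ofExt J i φ.le, ← Category.assoc, ← h]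
    simp
  exact congr($(h2).hom z)

theorem exists_classOf_eq (i : ℕ) {M : ModuleCat.{u} R} (ξ : (localCohomology J i).obj M) :
    ∃ (m : ℕ) (z : cocycles (res J m).complex i M), classOf J i m M z = ξ := by
  obtain ⟨m, x, rfl⟩ := exists_ofExt_eq J i ξ
  obtain ⟨z, rfl⟩ := extClass_surjective (res J m) i M x
  exact ⟨m, z, rfl⟩

theorem classOf_eq_zero_iff (i m : ℕ) {M : ModuleCat.{u} R}
    (z : cocycles (res J m).complex i M) :
    classOf J i m M z = 0 ↔ ∃ (m' : ℕ) (φ : Transition J m m') (j : ℕ)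
      (g : (res J m').complex.X j ⟶ M), (res J m').complex.d i j ≫ g = φ.hom.f i ≫ z.1 := by
  constructor
  · intro hz
    obtain ⟨m', hm, h⟩ := exists_of_ofExt_eq_zero J i m ((extClass (res J m) i M).hom z) hz
    obtain ⟨φ⟩ := exists_transition J hm
    refine ⟨m', φ, ?_⟩
    have h2 := congr($(extClass_pre (res J m) (res J m') (factorHom J φ.le) φ.hom φ.comm i M).hom z)
    exact (extClass_eq_zero_iff (res J m') i M (cocyclesPre φ.hom i M z)).1 (h2.symm.trans h)
  · rintro ⟨m', φ, h⟩
    rw [← classOf_pre i φ]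
    have := (extClass_eq_zero_iff (res J m') i M (cocyclesPre φ.hom i M z)).2 h
    simp only [classOf, ModuleCat.hom_comp, LinearMap.comp_apply, this, map_zero]

end LocalCohomologyClass

/-! ### Linearity, torsion and vanishing of local cohomology -/

/-- A total, additive, homogeneous relation that relates `0` only to `0` is the graph of a
linear map. -/
theorem exists_linearMap_of_rel {R M N : Type*} [CommRing R] [AddCommGroup M] [Module R M]
    [AddCommGroup N] [Module R N] (r : M → N → Prop) (total : ∀ x, ∃ y, r x y)
    (add : ∀ {x x' y y'}, r x y → r x' y' → r (x + x') (y + y'))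
    (smul : ∀ (a : R) {x y}, r x y → r (a • x) (a • y)) (zero : ∀ {y}, r 0 y → y = 0) :
    ∃ f : M →ₗ[R] N, ∀ x y, r x y ↔ f x = y := by
  have uniq : ∀ {x y y'}, r x y → r x y' → y = y' := fun {x y y'} h h' => by
    have := add h (smul (-1) h')
    simp only [neg_smul, one_smul, add_neg_cancel] at this
    exact eq_of_sub_eq_zero (by simpa [sub_eq_add_neg] using zero this)
  choose f hf using total
  exact ⟨{ toFun := f
           map_add' := fun x x' => uniq (hf _) (add (hf x) (hf x'))
           map_smul' := fun a x => uniq (hf _) (smul a (hf x)) },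
    fun x y => ⟨fun h => uniq (hf x) h, fun h => h ▸ hf x⟩⟩

namespace LocalCohomologyClass
open Limits Opposite ExtCocycle

section LongExact

variable {R : Type u} [CommRing R] {J : Ideal R}

theorem classOf_zero_iff (m : ℕ) {M : ModuleCat.{u} R} (z : cocycles (res J m).complex 0 M) :
    classOf J 0 m M z = 0 ↔ ∃ (m' : ℕ) (φ : Transition J m m'), φ.hom.f 0 ≫ z.1 = 0 := by
  rw [classOf_eq_zero_iff]
  refine exists_congr fun m' => exists_congr fun φ => ⟨?_, fun h => ⟨0, 0, by simp [h]⟩⟩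
  rintro ⟨j, g, h⟩
  rw [← h, HomologicalComplex.shape _ _ _ (by simp), zero_comp]

theorem classOf_succ_eq_zero_iff (i m : ℕ) {M : ModuleCat.{u} R}
    (z : cocycles (res J m).complex (i + 1) M) :
    classOf J (i + 1) m M z = 0 ↔ ∃ (m' : ℕ) (φ : Transition J m m')
      (g : (res J m').complex.X i ⟶ M),
        (res J m').complex.d (i + 1) i ≫ g = φ.hom.f (i + 1) ≫ z.1 := by
  rw [classOf_eq_zero_iff]
  refine exists_congr fun m' => exists_congr fun φ => ⟨?_, fun ⟨g, h⟩ => ⟨i, g, h⟩⟩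
  rintro ⟨j, g, h⟩
  by_cases hj : j = i
  · subst hj; exact ⟨g, h⟩
  · refine ⟨0, ?_⟩
    rw [← h, HomologicalComplex.shape _ (i + 1) j (by simp; omega), zero_comp, comp_zero]

/-- The augmentation of the chosen projective resolution of `R ⧸ J ^ m`. -/
def aug (J : Ideal R) (m : ℕ) : (res J m).complex.X 0 ⟶ ModuleCat.of R (R ⧸ J ^ m) :=
  (res J m).π.f 0

instance (m : ℕ) : Epi (aug J m) := inferInstanceAs (Epi ((res J m).π.f 0))

theorem d_comp_aug (m : ℕ) : (res J m).complex.d 1 0 ≫ aug J m = 0 :=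
  (res J m).complex_d_comp_π_f_zero

theorem exact_aug (m : ℕ) : (ShortComplex.mk _ _ (d_comp_aug (J := J) m)).Exact :=
  (res J m).exact₀

theorem Transition.comp_aug {m m' : ℕ} (φ : Transition J m m') :
    φ.hom.f 0 ≫ aug J m = aug J m' ≫ factorHom J φ.le :=
  φ.comm

theorem map_smul_id (i : ℕ) {M : ModuleCat.{u} R} (r : R) (ξ : (localCohomology J i).obj M) :
    ((localCohomology J i).map (r • 𝟙 M)).hom ξ = r • ξ := by
  obtain ⟨m, z, rfl⟩ := exists_classOf_eq i ξ
  rw [classOf_post, ← map_smul]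
  exact congrArg _ (Subtype.ext (by simp))

/-- Every local cohomology class is killed by a power of `J`: the maps of `Ext^i(R ⧸ J ^ m, M)`
induced by an element of `J ^ m` and by `0` agree. -/
theorem exists_pow_smul_eq_zero (i : ℕ) {M : ModuleCat.{u} R} (ξ : (localCohomology J i).obj M) :
    ∃ m : ℕ, ∀ r ∈ J ^ m, r • ξ = 0 := by
  obtain ⟨m, z, rfl⟩ := exists_classOf_eq i ξ
  refine ⟨m, fun r hr => ?_⟩
  have h0 : (0 : ModuleCat.of R (R ⧸ J ^ m) ⟶ ModuleCat.of R (R ⧸ J ^ m)) =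
      r • 𝟙 (ModuleCat.of R (R ⧸ J ^ m)) := by
    ext
    change (0 : R ⧸ J ^ m) = r • Submodule.Quotient.mk _
    rw [← Submodule.Quotient.mk_smul, eq_comm, Submodule.Quotient.mk_eq_zero]
    exact Ideal.mul_mem_right _ _ hr
  have h1 := extClass_pre (res J m) (res J m) 0 0
    (zero_comp.trans comp_zero.symm) i M
  have h2 := extClass_pre (res J m) (res J m) 0 (r • 𝟙 _) (by
    rw [h0]
    exact (by simp : (r • 𝟙 _) ≫ aug J m = aug J m ≫ (r • 𝟙 _))) i M
  have h3 := congr($(h1.symm.trans h2).hom z)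
  have h4 : (extClass (res J m) i M).hom (r • z) = 0 := by
    have e1 : cocyclesPre (r • 𝟙 (res J m).complex) i M z = r • z := Subtype.ext (by simp)
    have e2 : cocyclesPre (0 : (res J m).complex ⟶ (res J m).complex) i M z = 0 :=
      Subtype.ext (by simp)
    rw [← e1]
    refine h3.symm.trans ?_
    change (extClass (res J m) i M).hom (cocyclesPre 0 i M z) = 0
    rw [e2, map_zero]
  rw [← map_smul]
  change ((ofExt J i m).app M).hom ((extClass (res J m) i M).hom (r • z)) = 0
  rw [h4, map_zero]

/-- If some element of `J` acts bijectively on `M`, then `H^i_J(M) = 0` for all `i`. -/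
theorem eq_zero_of_bijective_smul (i : ℕ) {M : ModuleCat.{u} R} {t : R} (ht : t ∈ J)
    (hM : Function.Bijective fun x : M => t • x) (ξ : (localCohomology J i).obj M) : ξ = 0 := by
  have : IsIso (t • 𝟙 M) := (ConcreteCategory.isIso_iff_bijective _).2 hM
  have hinj : Function.Injective ((localCohomology J i).map (t • 𝟙 M)).hom :=
    (ModuleCat.mono_iff_injective _).1 inferInstance
  have key : ∀ (n : ℕ) (ξ : (localCohomology J i).obj M), t ^ n • ξ = 0 → ξ = 0 := by
    intro n
    induction n with
    | zero => intro ξ h; simpa using h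
    | succ n ih =>
      intro ξ h
      refine ih ξ (hinj ?_)
      rw [map_zero, map_smul_id, smul_smul, ← pow_succ', h]
  obtain ⟨m, hm⟩ := exists_pow_smul_eq_zero i ξ
  exact key m ξ (hm _ (Ideal.pow_mem_pow ht m))

theorem eq_zero_of_injective (i : ℕ) {M : ModuleCat.{u} R} [Injective M]
    (ξ : (localCohomology J (i + 1)).obj M) : ξ = 0 := by
  obtain ⟨m, z, rfl⟩ := exists_classOf_eq (i + 1) ξ
  obtain ⟨φ⟩ := exists_transition J le_rfl
  rw [← classOf_pre _ φ, classOf_succ_eq_zero_iff]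
  obtain ⟨ψ⟩ := exists_transition J (le_refl m)
  have hex := (res J m).exact_succ i
  refine ⟨m, ψ, hex.descToInjective (ψ.hom.f (i + 1) ≫ (cocyclesPre φ.hom (i + 1) M z).1) ?_, ?_⟩
  · exact (cocyclesPre ψ.hom (i + 1) M (cocyclesPre φ.hom (i + 1) M z)).2
  · exact hex.comp_descToInjective _ _

/-! ### The connecting homomorphism -/

section Connecting

variable {S : ShortComplex (ModuleCat.{u} R)}

/-- The graph of the connecting homomorphism `H^i_J(S.X₃) → H^{i+1}_J(S.X₁)`: a cocycle `z`
with values in `S.X₃` is lifted to a cochain `l` with values in `S.X₂`, whose coboundary comes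
from a cocycle `w` with values in `S.X₁`. -/
def IsConnecting (J : Ideal R) (S : ShortComplex (ModuleCat.{u} R)) (i : ℕ)
    (ξ : (localCohomology J i).obj S.X₃) (η : (localCohomology J (i + 1)).obj S.X₁) : Prop :=
  ∃ (m : ℕ) (z : cocycles (res J m).complex i S.X₃) (w : cocycles (res J m).complex (i + 1) S.X₁)
    (l : (res J m).complex.X i ⟶ S.X₂), l ≫ S.g = z ∧
      w.1 ≫ S.f = (res J m).complex.d (i + 1) i ≫ l ∧
        classOf J i m _ z = ξ ∧ classOf J (i + 1) m _ w = η

theorem IsConnecting.exists_ge {i : ℕ} {ξ : (localCohomology J i).obj S.X₃}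
    {η : (localCohomology J (i + 1)).obj S.X₁} (h : IsConnecting J S i ξ η) :
    ∃ n, ∀ m ≥ n, ∃ (z : cocycles (res J m).complex i S.X₃)
      (w : cocycles (res J m).complex (i + 1) S.X₁)
      (l : (res J m).complex.X i ⟶ S.X₂), l ≫ S.g = z ∧
      w.1 ≫ S.f = (res J m).complex.d (i + 1) i ≫ l ∧
        classOf J i m _ z = ξ ∧ classOf J (i + 1) m _ w = η := by
  obtain ⟨n, z, w, l, h1, h2, h3, h4⟩ := h
  refine ⟨n, fun m hm => ?_⟩
  obtain ⟨φ⟩ := exists_transition J hm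
  refine ⟨cocyclesPre φ.hom _ _ z, cocyclesPre φ.hom _ _ w, φ.hom.f i ≫ l, ?_, ?_, ?_, ?_⟩
  · simp [h1]
  · simp [h2]
  · rw [classOf_pre, h3]
  · rw [classOf_pre, h4]

theorem IsConnecting.add {i : ℕ} {ξ ξ' : (localCohomology J i).obj S.X₃}
    {η η' : (localCohomology J (i + 1)).obj S.X₁} (h : IsConnecting J S i ξ η)
    (h' : IsConnecting J S i ξ' η') : IsConnecting J S i (ξ + ξ') (η + η') := by
  obtain ⟨n, h⟩ := h.exists_ge
  obtain ⟨n', h'⟩ := h'.exists_ge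
  obtain ⟨z, w, l, h1, h2, h3, h4⟩ := h (max n n') (le_max_left _ _)
  obtain ⟨z', w', l', h1', h2', h3', h4'⟩ := h' (max n n') (le_max_right _ _)
  exact ⟨max n n', z + z', w + w', l + l', by simp [h1, h1'], by simp [h2, h2'],
    by rw [map_add, h3, h3'], by rw [map_add, h4, h4']⟩

theorem IsConnecting.smul {i : ℕ} (r : R) {ξ : (localCohomology J i).obj S.X₃}
    {η : (localCohomology J (i + 1)).obj S.X₁} (h : IsConnecting J S i ξ η) :
    IsConnecting J S i (r • ξ) (r • η) := by
  obtain ⟨n, z, w, l, h1, h2, h3, h4⟩ := h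
  exact ⟨n, r • z, r • w, r • l, by simp [h1], by simp [h2],
    by rw [map_smul, h3], by rw [map_smul, h4]⟩

variable (hS : S.ShortExact)
include hS

theorem exists_isConnecting (i : ℕ) (ξ : (localCohomology J i).obj S.X₃) :
    ∃ η, IsConnecting J S i ξ η := by
  obtain ⟨m, z, rfl⟩ := exists_classOf_eq i ξ
  have := hS.epi_g
  have := hS.mono_f
  let l := Projective.factorThru z.1 S.g
  have hl : l ≫ S.g = z := Projective.factorThru_comp _ _
  have h0 : ((res J m).complex.d (i + 1) i ≫ l) ≫ S.g = 0 := by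
    rw [Category.assoc, hl]; exact z.2
  let w := hS.exact.lift _ h0
  have hw : w ≫ S.f = (res J m).complex.d (i + 1) i ≫ l := hS.exact.lift_f _ h0
  have hw' : w ∈ cocycles (res J m).complex (i + 1) S.X₁ := by
    rw [mem_cocycles, ← cancel_mono S.f, Category.assoc, hw]
    simp
  exact ⟨_, m, z, ⟨w, hw'⟩, l, hl, hw, rfl, rfl⟩

theorem IsConnecting.eq_zero {i : ℕ}
    {η : (localCohomology J (i + 1)).obj S.X₁} (h : IsConnecting J S i 0 η) : η = 0 := by
  obtain ⟨n, z, w, l, h1, h2, h3, h4⟩ := h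
  have := hS.epi_g
  have := hS.mono_f
  rw [classOf_eq_zero_iff] at h3
  obtain ⟨m, φ, j, c, hc⟩ := h3
  rw [← h4, classOf_succ_eq_zero_iff]
  let c' := Projective.factorThru c S.g
  have hc' : c' ≫ S.g = c := Projective.factorThru_comp _ _
  have h0 : (φ.hom.f i ≫ l - (res J m).complex.d i j ≫ c') ≫ S.g = 0 := by
    simp [h1, hc', hc]
  refine ⟨m, φ, hS.exact.lift _ h0, ?_⟩
  rw [← cancel_mono S.f, Category.assoc, hS.exact.lift_f _ h0, Category.assoc, h2]
  simp

theorem exists_connecting (J : Ideal R) (i : ℕ) :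
    ∃ f : (localCohomology J i).obj S.X₃ →ₗ[R] (localCohomology J (i + 1)).obj S.X₁,
      ∀ ξ η, IsConnecting J S i ξ η ↔ f ξ = η :=
  exists_linearMap_of_rel _ (exists_isConnecting hS i) (fun h h' => h.add h')
    (fun r _ _ h => h.smul r) (fun h => h.eq_zero hS)

/-- The connecting homomorphism of local cohomology attached to a short exact sequence. -/
def connecting (J : Ideal R) (i : ℕ) :
    (localCohomology J i).obj S.X₃ →ₗ[R] (localCohomology J (i + 1)).obj S.X₁ :=
  (exists_connecting hS J i).choose

theorem isConnecting_iff {i : ℕ} {ξ : (localCohomology J i).obj S.X₃}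
    {η : (localCohomology J (i + 1)).obj S.X₁} :
    IsConnecting J S i ξ η ↔ connecting hS J i ξ = η :=
  (exists_connecting hS J i).choose_spec ξ η

theorem isConnecting_connecting (i : ℕ) (ξ : (localCohomology J i).obj S.X₃) :
    IsConnecting J S i ξ (connecting hS J i ξ) :=
  (isConnecting_iff hS).2 rfl

theorem IsConnecting.connecting_eq {i : ℕ} {ξ : (localCohomology J i).obj S.X₃}
    {η : (localCohomology J (i + 1)).obj S.X₁} (h : IsConnecting J S i ξ η) :
    connecting hS J i ξ = η :=
  (isConnecting_iff hS).1 h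

theorem connecting_map_g (i : ℕ) (ξ : (localCohomology J i).obj S.X₂) :
    connecting hS J i (((localCohomology J i).map S.g).hom ξ) = 0 := by
  obtain ⟨m, z, rfl⟩ := exists_classOf_eq i ξ
  refine IsConnecting.connecting_eq hS ⟨m, cocyclesPost _ _ S.g z, 0, z.1, rfl, ?_,
    (classOf_post J i m S.g z).symm, map_zero _⟩
  rw [mem_cocycles.1 z.2]
  exact zero_comp

theorem connecting_naturality {S' : ShortComplex (ModuleCat.{u} R)} (hS' : S'.ShortExact)
    (τ : S ⟶ S') (i : ℕ) (ξ : (localCohomology J i).obj S.X₃) :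
    ((localCohomology J (i + 1)).map τ.τ₁).hom (connecting hS J i ξ) =
      connecting hS' J i (((localCohomology J i).map τ.τ₃).hom ξ) := by
  symm
  apply IsConnecting.connecting_eq
  obtain ⟨n, z, w, l, h1, h2, h3, h4⟩ := isConnecting_connecting hS i ξ
  refine ⟨n, cocyclesPost _ _ τ.τ₃ z, cocyclesPost _ _ τ.τ₁ w, l ≫ τ.τ₂, ?_, ?_, ?_, ?_⟩
  · simp [← h1, τ.comm₂₃]
  · simp [τ.comm₁₂, ← reassoc_of% h2]
  · rw [← classOf_post, h3]
  · rw [← classOf_post, h4]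

/-- Exactness at `H^{i+1}_J(S.X₁)`. -/
theorem exists_connecting_eq (i : ℕ) (η : (localCohomology J (i + 1)).obj S.X₁)
    (hη : ((localCohomology J (i + 1)).map S.f).hom η = 0) :
    ∃ ξ, connecting hS J i ξ = η := by
  obtain ⟨m, w, rfl⟩ := exists_classOf_eq (i + 1) η
  rw [classOf_post, classOf_succ_eq_zero_iff] at hη
  obtain ⟨m', φ, l, hl⟩ := hη
  refine ⟨classOf J i m' _ ⟨l ≫ S.g, ?_⟩, IsConnecting.connecting_eq hS
    ⟨m', _, cocyclesPre φ.hom _ _ w, l, rfl, ?_, rfl, classOf_pre _ φ _ _⟩⟩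
  · rw [mem_cocycles, reassoc_of% hl]
    simp
  · simp [hl]

/-- Exactness at `H^i_J(S.X₂)`. -/
theorem exists_map_f_eq (i : ℕ) (ξ : (localCohomology J i).obj S.X₂)
    (hξ : ((localCohomology J i).map S.g).hom ξ = 0) :
    ∃ η, ((localCohomology J i).map S.f).hom η = ξ := by
  have := hS.epi_g
  have := hS.mono_f
  obtain ⟨n, z, rfl⟩ := exists_classOf_eq i ξ
  rw [classOf_post, classOf_eq_zero_iff] at hξ
  obtain ⟨m, φ, j, c, hc⟩ := hξ
  let c' := Projective.factorThru c S.g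
  have hc' : c' ≫ S.g = c := Projective.factorThru_comp _ _
  have h0 : (φ.hom.f i ≫ z.1 - (res J m).complex.d i j ≫ c') ≫ S.g = 0 := by
    simp [hc', hc]
  let b : cocycles (res J m).complex i S.X₂ := ⟨(res J m).complex.d i j ≫ c', by
    simp [mem_cocycles]⟩
  have hb : classOf J i m _ b = 0 := by
    rw [classOf_eq_zero_iff]
    obtain ⟨ψ⟩ := exists_transition J (le_refl m)
    exact ⟨m, ψ, j, ψ.hom.f j ≫ c', by simp [b]⟩
  have hw : hS.exact.lift _ h0 ∈ cocycles (res J m).complex i S.X₁ := by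
    rw [mem_cocycles, ← cancel_mono S.f, Category.assoc, hS.exact.lift_f _ h0]
    have := (cocyclesPre φ.hom i _ z - b).2
    rw [mem_cocycles] at this
    exact this.trans zero_comp.symm
  refine ⟨classOf J i m _ ⟨_, hw⟩, ?_⟩
  have e : cocyclesPost _ i S.f ⟨_, hw⟩ = cocyclesPre φ.hom i _ z - b :=
    Subtype.ext (hS.exact.lift_f _ h0)
  rw [classOf_post, e, map_sub, hb, classOf_pre, sub_zero]

/-- Exactness at `H^i_J(S.X₃)`. -/
theorem exists_map_g_eq (i : ℕ) (ξ : (localCohomology J i).obj S.X₃)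
    (hξ : connecting hS J i ξ = 0) :
    ∃ η, ((localCohomology J i).map S.g).hom η = ξ := by
  obtain ⟨n, z, w, l, h1, h2, h3, h4⟩ := isConnecting_connecting hS i ξ
  rw [hξ, classOf_succ_eq_zero_iff] at h4
  obtain ⟨m, φ, u, hu⟩ := h4
  refine ⟨classOf J i m _ ⟨φ.hom.f i ≫ l - u ≫ S.f, ?_⟩, ?_⟩
  · rw [mem_cocycles]
    simp [reassoc_of% hu, h2]
  · rw [classOf_post, ← h3, ← classOf_pre i φ]
    congr 1
    apply Subtype.ext
    simp [h1]

theorem connecting_injective (i : ℕ) (h : ∀ ξ : (localCohomology J i).obj S.X₂, ξ = 0) :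
    Function.Injective (connecting hS J i) := by
  rw [injective_iff_map_eq_zero]
  intro ξ hξ
  obtain ⟨η, rfl⟩ := exists_map_g_eq hS i ξ hξ
  rw [h η, map_zero]

theorem connecting_surjective (i : ℕ) (h : ∀ ξ : (localCohomology J (i + 1)).obj S.X₂, ξ = 0) :
    Function.Surjective (connecting hS J i) := fun η =>
  exists_connecting_eq hS i η (h _)

theorem map_g_injective (i : ℕ) (h : ∀ ξ : (localCohomology J i).obj S.X₁, ξ = 0) :
    Function.Injective ((localCohomology J i).map S.g).hom := by
  rw [injective_iff_map_eq_zero]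
  intro ξ hξ
  obtain ⟨η, rfl⟩ := exists_map_f_eq hS i ξ hξ
  rw [h η, map_zero]

end Connecting

/-! ### Degree zero -/

/-- The elements of `M` that are killed by a power of `J`. -/
def powTorsion (J : Ideal R) (M : Type*) [AddCommGroup M] [Module R M] : Submodule R M where
  carrier := {x | ∃ m : ℕ, ∀ r ∈ J ^ m, r • x = 0}
  add_mem' := by
    rintro x y ⟨m, hx⟩ ⟨n, hy⟩
    refine ⟨m + n, fun r hr => ?_⟩
    rw [smul_add, hx r (Ideal.pow_le_pow_right (by omega) hr),
      hy r (Ideal.pow_le_pow_right (by omega) hr), add_zero]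
  zero_mem' := ⟨0, fun r _ => smul_zero r⟩
  smul_mem' := by
    rintro a x ⟨m, hx⟩
    exact ⟨m, fun r hr => by rw [smul_comm, hx r hr, smul_zero]⟩

theorem mem_powTorsion {M : Type*} [AddCommGroup M] [Module R M] {x : M} :
    x ∈ powTorsion J M ↔ ∃ m : ℕ, ∀ r ∈ J ^ m, r • x = 0 := Iff.rfl

/-- The map `R ⧸ J ^ m → M` that sends `1` to an element killed by `J ^ m`. -/
def quotHom {M : ModuleCat.{u} R} {m : ℕ} (x : M) (hx : ∀ r ∈ J ^ m, r • x = 0) :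
    ModuleCat.of R (R ⧸ J ^ m) ⟶ M :=
  ModuleCat.ofHom ((J ^ m).liftQ (LinearMap.toSpanSingleton R M x) fun r hr =>
    LinearMap.mem_ker.2 (hx r hr))

theorem quotHom_mk {M : ModuleCat.{u} R} {m : ℕ} (x : M) (hx : ∀ r ∈ J ^ m, r • x = 0) (r : R) :
    (quotHom x hx).hom (Submodule.Quotient.mk r) = r • x := rfl

theorem hom_ext_one {M : ModuleCat.{u} R} {m : ℕ} {f g : ModuleCat.of R (R ⧸ J ^ m) ⟶ M}
    (h : f.hom (Submodule.Quotient.mk 1) = g.hom (Submodule.Quotient.mk 1)) : f = g := by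
  ext
  exact h

/-- The `0`-cocycle of an element killed by `J ^ m`. -/
def zeroCocycle {M : ModuleCat.{u} R} {m : ℕ} (x : M) (hx : ∀ r ∈ J ^ m, r • x = 0) :
    cocycles (res J m).complex 0 M :=
  ⟨aug J m ≫ quotHom x hx, by
    rw [mem_cocycles, ← Category.assoc, d_comp_aug, zero_comp]⟩

theorem zeroCocycle_pre {M : ModuleCat.{u} R} {m m' : ℕ} (φ : Transition J m m') (x : M)
    (hx : ∀ r ∈ J ^ m, r • x = 0) :
    cocyclesPre φ.hom 0 M (zeroCocycle x hx) =
      zeroCocycle x fun r hr => hx r (Ideal.pow_le_pow_right φ.le hr) := by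
  apply Subtype.ext
  rw [cocyclesPre_coe, zeroCocycle, zeroCocycle, ← Category.assoc, φ.comp_aug, Category.assoc]
  exact congrArg _ (hom_ext_one rfl)

theorem zeroCocycle_post {M N : ModuleCat.{u} R} {m : ℕ} (g : M ⟶ N) (x : M)
    (hx : ∀ r ∈ J ^ m, r • x = 0) :
    cocyclesPost _ 0 g (zeroCocycle x hx) =
      zeroCocycle (g.hom x) fun r hr => by rw [← map_smul, hx r hr, map_zero] := by
  apply Subtype.ext
  rw [cocyclesPost_coe, zeroCocycle, zeroCocycle, Category.assoc]
  congr 1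
  apply hom_ext_one
  change g.hom ((1 : R) • x) = (1 : R) • g.hom x
  rw [map_smul]

theorem eq_zero_of_zeroCocycle_eq_zero {M : ModuleCat.{u} R} {m : ℕ} (x : M)
    (hx : ∀ r ∈ J ^ m, r • x = 0) (h : (zeroCocycle x hx).1 = 0) : x = 0 := by
  have h2 : quotHom x hx = 0 := by
    rw [← cancel_epi (aug J m)]
    exact h.trans comp_zero.symm
  simpa [h2] using (quotHom_mk x hx 1).symm

theorem classOf_zeroCocycle_eq_zero {M : ModuleCat.{u} R} {m : ℕ} (x : M)
    (hx : ∀ r ∈ J ^ m, r • x = 0) (h : classOf J 0 m M (zeroCocycle x hx) = 0) : x = 0 := by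
  obtain ⟨m', φ, h⟩ := (classOf_zero_iff _ _).1 h
  have h2 := zeroCocycle_pre φ x hx
  exact eq_zero_of_zeroCocycle_eq_zero x _ ((congrArg Subtype.val h2).symm.trans h)

theorem exists_zeroCocycle_eq {M : ModuleCat.{u} R} {m : ℕ}
    (z : cocycles (res J m).complex 0 M) : ∃ (x : M) (hx : ∀ r ∈ J ^ m, r • x = 0),
      zeroCocycle x hx = z := by
  let f := (exact_aug (J := J) m).desc z.1 z.2
  have hf : aug J m ≫ f = z.1 := (exact_aug (J := J) m).g_desc z.1 z.2
  have key : ∀ r : R, f.hom (Submodule.Quotient.mk r) = r • f.hom (Submodule.Quotient.mk 1) := by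
    intro r
    rw [← map_smul, ← Submodule.Quotient.mk_smul, smul_eq_mul, mul_one]
  refine ⟨f.hom (Submodule.Quotient.mk 1), fun r hr => ?_, Subtype.ext ?_⟩
  · rw [← key, (Submodule.Quotient.mk_eq_zero _).2 hr, map_zero]
  · rw [← hf]
    change aug J m ≫ _ = aug J m ≫ f
    congr 1
    apply hom_ext_one
    rw [quotHom_mk, one_smul]

/-- `ξ` is the class in `H^0_J(M)` of the `J`-power torsion element `x` of `M`. -/
def IsDegreeZeroClass {M : ModuleCat.{u} R} (x : powTorsion J M)
    (ξ : (localCohomology J 0).obj M) : Prop :=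
  ∃ (m : ℕ) (hx : ∀ r ∈ J ^ m, r • x.1 = 0), classOf J 0 m M (zeroCocycle x.1 hx) = ξ

theorem exists_ofPowTorsion (J : Ideal R) (M : ModuleCat.{u} R) :
    ∃ f : powTorsion J M →ₗ[R] (localCohomology J 0).obj M,
      ∀ x ξ, IsDegreeZeroClass x ξ ↔ f x = ξ := by
  refine exists_linearMap_of_rel _ (fun x => ⟨_, x.2.choose, x.2.choose_spec, rfl⟩) ?_ ?_ ?_
  · rintro x y _ _ ⟨m, hx, rfl⟩ ⟨n, hy, rfl⟩
    obtain ⟨φ⟩ := exists_transition J (le_max_left m n)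
    obtain ⟨ψ⟩ := exists_transition J (le_max_right m n)
    have hx' : ∀ r ∈ J ^ max m n, r • x.1 = 0 := fun r hr =>
      hx r (Ideal.pow_le_pow_right φ.le hr)
    have hy' : ∀ r ∈ J ^ max m n, r • y.1 = 0 := fun r hr =>
      hy r (Ideal.pow_le_pow_right ψ.le hr)
    refine ⟨max m n, fun r hr => by
      rw [Submodule.coe_add, smul_add, hx' r hr, hy' r hr, add_zero], ?_⟩
    rw [← classOf_pre 0 φ, ← classOf_pre 0 ψ, zeroCocycle_pre, zeroCocycle_pre, ← map_add]
    congr 1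
    apply Subtype.ext
    simp only [zeroCocycle, Submodule.coe_add, ← Preadditive.comp_add]
    congr 1
    apply hom_ext_one
    change (1 : R) • (x.1 + y.1) = (1 : R) • x.1 + (1 : R) • y.1
    rw [smul_add]
  · rintro a x _ ⟨m, hx, rfl⟩
    refine ⟨m, fun r hr => by
      rw [Submodule.coe_smul, smul_comm, hx r hr, smul_zero], ?_⟩
    rw [← map_smul]
    congr 1
    apply Subtype.ext
    simp only [zeroCocycle, Submodule.coe_smul, ← Linear.comp_smul]
    congr 1
    apply hom_ext_one
    change (1 : R) • (a • x.1) = a • (1 : R) • x.1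
    rw [one_smul, one_smul]
  · rintro _ ⟨m, hx, rfl⟩
    rw [← map_zero (classOf J 0 m M)]
    congr 1
    apply Subtype.ext
    change aug J m ≫ _ = 0
    rw [← comp_zero]
    congr 1
    apply hom_ext_one
    change (1 : R) • (0 : M) = 0
    rw [smul_zero]

/-- The class in `H^0_J(M)` of an element of `M` killed by a power of `J`. -/
def ofPowTorsion (J : Ideal R) (M : ModuleCat.{u} R) :
    powTorsion J M →ₗ[R] (localCohomology J 0).obj M :=
  (exists_ofPowTorsion J M).choose

theorem ofPowTorsion_rel {M : ModuleCat.{u} R} (x : powTorsion J M) :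
    ∃ (m : ℕ) (hx : ∀ r ∈ J ^ m, r • x.1 = 0),
      classOf J 0 m M (zeroCocycle x.1 hx) = ofPowTorsion J M x :=
  ((exists_ofPowTorsion J M).choose_spec x _).2 rfl

theorem ofPowTorsion_eq {M : ModuleCat.{u} R} (x : powTorsion J M)
    (m : ℕ) (hx : ∀ r ∈ J ^ m, r • x.1 = 0) :
    ofPowTorsion J M x = classOf J 0 m M (zeroCocycle x.1 hx) :=
  ((exists_ofPowTorsion J M).choose_spec x _).1 ⟨m, hx, rfl⟩

theorem ofPowTorsion_bijective (J : Ideal R) (M : ModuleCat.{u} R) :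
    Function.Bijective (ofPowTorsion J M) := by
  constructor
  · rw [injective_iff_map_eq_zero]
    intro x hx
    obtain ⟨m, h, e⟩ := ofPowTorsion_rel x
    exact Subtype.ext (classOf_zeroCocycle_eq_zero x.1 h (e.trans hx))
  · intro ξ
    obtain ⟨m, z, rfl⟩ := exists_classOf_eq 0 ξ
    obtain ⟨x, hx, rfl⟩ := exists_zeroCocycle_eq z
    exact ⟨⟨x, m, hx⟩, ofPowTorsion_eq _ m hx⟩

theorem map_mem_powTorsion {M N : ModuleCat.{u} R} (g : M ⟶ N) {x : M}
    (hx : x ∈ powTorsion J M) : g.hom x ∈ powTorsion J N := by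
  obtain ⟨m, hx⟩ := hx
  exact ⟨m, fun r hr => by rw [← map_smul, hx r hr, map_zero]⟩

theorem map_ofPowTorsion {M N : ModuleCat.{u} R} (g : M ⟶ N) (x : powTorsion J M)
    (y : powTorsion J N) (hy : g.hom x.1 = y.1) :
    ((localCohomology J 0).map g).hom (ofPowTorsion J M x) = ofPowTorsion J N y := by
  obtain ⟨m, h, e⟩ := ofPowTorsion_rel x
  obtain ⟨y, hy'⟩ := y
  obtain rfl : g.hom x.1 = y := hy
  rw [← e, classOf_post, zeroCocycle_post, ofPowTorsion_eq _ m]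

theorem map_ofPowTorsion_eq_zero_iff {M N : ModuleCat.{u} R} (g : M ⟶ N) (x : powTorsion J M) :
    ((localCohomology J 0).map g).hom (ofPowTorsion J M x) = 0 ↔ g.hom x.1 = 0 := by
  rw [map_ofPowTorsion g x ⟨_, map_mem_powTorsion g x.2⟩ rfl,
    map_eq_zero_iff _ (ofPowTorsion_bijective _ _).1]
  exact Subtype.ext_iff

/-- If `J` kills `M`, then `H^1_J(M) = 0`: in an embedding of `M` in an injective module `I`,
every `J`-power torsion element of `I ⧸ M` lifts to a `J`-power torsion element of `I`. -/
theorem eq_zero_of_smul_eq_zero {M : ModuleCat.{u} R} (hM : ∀ r ∈ J, ∀ x : M, r • x = 0)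
    (ξ : (localCohomology J 1).obj M) : ξ = 0 := by
  let S := ShortComplex.mk (Injective.ι M) (cokernel.π (Injective.ι M)) (cokernel.condition _)
  have hS : S.ShortExact :=
    { exact := S.exact_of_g_is_cokernel (cokernelIsCokernel _)
      mono_f := inferInstanceAs (Mono (Injective.ι M))
      epi_g := inferInstanceAs (Epi (cokernel.π _)) }
  have : Injective S.X₂ := inferInstanceAs (Injective (Injective.under M))
  obtain ⟨η, rfl⟩ := exists_connecting_eq hS 0 ξ (eq_zero_of_injective 0 _)
  obtain ⟨⟨y, m, hy⟩, rfl⟩ := (ofPowTorsion_bijective J S.X₃).2 η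
  obtain ⟨x, rfl⟩ := hS.moduleCat_surjective_g y
  have hx : ∀ r ∈ J ^ (m + 1), r • x = 0 := by
    intro r hr
    rw [pow_succ] at hr
    refine Submodule.mul_induction_on hr (fun a ha b hb => ?_) fun a b ha hb => by
      rw [add_smul, ha, hb, add_zero]
    have hg : S.g.hom (a • x) = 0 := by rw [map_smul]; exact hy a ha
    obtain ⟨z, hz⟩ := (ShortComplex.moduleCat_exact_iff _).1 hS.exact _ hg
    have hz' : S.f.hom (b • z) = b • (a • x) := by rw [map_smul]; exact congrArg _ hz
    rw [mul_comm, mul_smul, ← hz', hM b hb, map_zero]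
  have e := map_ofPowTorsion S.g ⟨x, m + 1, hx⟩ ⟨S.g.hom x, m, hy⟩ rfl
  have e' := connecting_map_g hS 0 (ofPowTorsion J S.X₂ ⟨x, m + 1, hx⟩)
  rw [e] at e'
  exact e'

end LongExact

/-! ### Short exact sequences of submodules and their Frobenius pushforwards -/

section Sequences

variable {R : Type u} [CommRing R] {J : Ideal R}

theorem shortExact_of_exact {S : ShortComplex (ModuleCat.{u} R)}
    (hf : Function.Injective S.f.hom) (hg : Function.Surjective S.g.hom)
    (h : Function.Exact S.f.hom S.g.hom) : S.ShortExact where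
  exact := (ShortComplex.ShortExact.moduleCat_exact_iff_function_exact S).2 h
  mono_f := (ModuleCat.mono_iff_injective _).2 hf
  epi_g := (ModuleCat.epi_iff_surjective _).2 hg

/-- The sequence `M → E → E ⧸ f(M)`. -/
def cokerSeq {M E : Type u} [AddCommGroup M] [Module R M] [AddCommGroup E] [Module R E]
    (f : M →ₗ[R] E) : ShortComplex (ModuleCat.{u} R) :=
  ShortComplex.mk (ModuleCat.ofHom f) (ModuleCat.ofHom (LinearMap.range f).mkQ) (by
    ext x
    exact (Submodule.Quotient.mk_eq_zero _).2 ⟨x, rfl⟩)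

theorem cokerSeq_shortExact {M E : Type u} [AddCommGroup M] [Module R M] [AddCommGroup E]
    [Module R E] (f : M →ₗ[R] E) (hf : Function.Injective f) : (cokerSeq f).ShortExact :=
  shortExact_of_exact hf (Submodule.mkQ_surjective _)
    (LinearMap.exact_iff.2 (Submodule.ker_mkQ _))

/-- The sequence `ker g → M → N`. -/
def kerSeq {M N : Type u} [AddCommGroup M] [Module R M] [AddCommGroup N] [Module R N]
    (g : M →ₗ[R] N) : ShortComplex (ModuleCat.{u} R) :=
  ShortComplex.mk (ModuleCat.ofHom (LinearMap.ker g).subtype) (ModuleCat.ofHom g) (by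
    ext x
    exact x.2)

theorem kerSeq_shortExact {M N : Type u} [AddCommGroup M] [Module R M] [AddCommGroup N]
    [Module R N] (g : M →ₗ[R] N) (hg : Function.Surjective g) : (kerSeq g).ShortExact :=
  shortExact_of_exact (Submodule.subtype_injective _) hg
    (LinearMap.exact_iff.2 (Submodule.range_subtype _).symm)

variable {E : Type u} [AddCommGroup E] [Module R E]

/-- The difference map `E ⧸ P × E ⧸ Q → E ⧸ (P + Q)`. -/
def quotDiff (P Q : Submodule R E) : ((E ⧸ P) × (E ⧸ Q)) →ₗ[R] E ⧸ (P ⊔ Q) :=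
  (Submodule.factor le_sup_left).comp (LinearMap.fst R _ _) -
    (Submodule.factor le_sup_right).comp (LinearMap.snd R _ _)

/-- The diagonal map `E ⧸ (P ∩ Q) → E ⧸ P × E ⧸ Q`. -/
def quotDiag (P Q : Submodule R E) : (E ⧸ (P ⊓ Q)) →ₗ[R] (E ⧸ P) × (E ⧸ Q) :=
  (Submodule.factor inf_le_left).prod (Submodule.factor inf_le_right)

theorem quotDiag_mk (P Q : Submodule R E) (x : E) :
    quotDiag P Q (Submodule.Quotient.mk x) =
      (Submodule.Quotient.mk x, Submodule.Quotient.mk x) := rfl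

theorem quotDiff_mk (P Q : Submodule R E) (x y : E) :
    quotDiff P Q (Submodule.Quotient.mk x, Submodule.Quotient.mk y) =
      Submodule.Quotient.mk (x - y) := rfl

theorem quotDiag_injective (P Q : Submodule R E) : Function.Injective (quotDiag P Q) := by
  rw [injective_iff_map_eq_zero]
  intro x
  obtain ⟨x, rfl⟩ := Submodule.Quotient.mk_surjective _ x
  rw [quotDiag_mk, Prod.mk_eq_zero, Submodule.Quotient.mk_eq_zero, Submodule.Quotient.mk_eq_zero,
    Submodule.Quotient.mk_eq_zero]
  exact fun h => h

theorem quotDiff_surjective (P Q : Submodule R E) : Function.Surjective (quotDiff P Q) := by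
  intro x
  obtain ⟨x, rfl⟩ := Submodule.Quotient.mk_surjective _ x
  exact ⟨(Submodule.Quotient.mk x, Submodule.Quotient.mk 0), by rw [quotDiff_mk, sub_zero]⟩

theorem exact_quotDiag_quotDiff (P Q : Submodule R E) :
    Function.Exact (quotDiag P Q) (quotDiff P Q) := by
  rintro ⟨x, y⟩
  obtain ⟨x, rfl⟩ := Submodule.Quotient.mk_surjective _ x
  obtain ⟨y, rfl⟩ := Submodule.Quotient.mk_surjective _ y
  rw [quotDiff_mk, Submodule.Quotient.mk_eq_zero]
  constructor
  · intro h
    obtain ⟨a, ha, b, hb, hab⟩ := Submodule.mem_sup.1 h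
    refine ⟨Submodule.Quotient.mk (x - a), ?_⟩
    rw [quotDiag_mk, Prod.mk.injEq, Submodule.Quotient.eq, Submodule.Quotient.eq]
    refine ⟨by simpa using ha, ?_⟩
    have : x - a - y = b := by rw [eq_sub_of_add_eq' hab]; abel
    rwa [this]
  · rintro ⟨z, hz⟩
    obtain ⟨z, rfl⟩ := Submodule.Quotient.mk_surjective _ z
    rw [quotDiag_mk, Prod.mk.injEq, Submodule.Quotient.eq, Submodule.Quotient.eq] at hz
    have e : x - y = z - y - (z - x) := by abel
    rw [e, sup_comm]
    exact Submodule.sub_mem_sup hz.2 hz.1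

/-- The Mayer–Vietoris sequence `E ⧸ (P ∩ Q) → E ⧸ P × E ⧸ Q → E ⧸ (P + Q)`. -/
def mvSeq (P Q : Submodule R E) : ShortComplex (ModuleCat.{u} R) :=
  ShortComplex.mk (ModuleCat.ofHom (quotDiag P Q)) (ModuleCat.ofHom (quotDiff P Q)) (by
    ext x
    exact ((exact_quotDiag_quotDiff P Q).apply_apply_eq_zero _))

theorem mvSeq_shortExact (P Q : Submodule R E) : (mvSeq P Q).ShortExact :=
  shortExact_of_exact (quotDiag_injective P Q) (quotDiff_surjective P Q)
    (exact_quotDiag_quotDiff P Q)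

/-- Restriction of scalars along an endomorphism `φ` of `R`. -/
abbrev push (φ : R →+* R) : ModuleCat.{u} R ⥤ ModuleCat.{u} R := ModuleCat.restrictScalars φ

theorem push_shortExact (φ : R →+* R) {S : ShortComplex (ModuleCat.{u} R)} (hS : S.ShortExact) :
    (S.map (push φ)).ShortExact :=
  hS.map_of_exact _

theorem eq_zero_of_push_bijective_smul (φ : R →+* R) (i : ℕ) {M : ModuleCat.{u} R} {t : R}
    (ht : t ∈ J) (hM : Function.Bijective fun x : M => φ t • x)
    (ξ : (localCohomology J i).obj ((push φ).obj M)) : ξ = 0 :=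
  eq_zero_of_bijective_smul i ht hM ξ

theorem eq_zero_of_push_smul_eq_zero (φ : R →+* R) {M : ModuleCat.{u} R}
    (hM : ∀ r ∈ J, ∀ x : M, φ r • x = 0)
    (ξ : (localCohomology J 1).obj ((push φ).obj M)) : ξ = 0 :=
  eq_zero_of_smul_eq_zero hM ξ

/-- A map that is semilinear over `φ`, as a linear map to the restriction of scalars. -/
def toPush {φ : R →+* R} {M N : Type u} [AddCommGroup M] [Module R M]
    [AddCommGroup N] [Module R N] (f : M →ₛₗ[φ] N) :
    ModuleCat.of R M ⟶ (push φ).obj (ModuleCat.of R N) :=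
  ModuleCat.semilinearMapAddEquiv φ (ModuleCat.of R M) (ModuleCat.of R N) f

end Sequences

/-! ### Frobenius on an algebra and on its quotients -/

section Frobenius

variable {R : Type u} [CommRing R] (p : ℕ) [Fact p.Prime] [CharP R p]
  {E : Type u} [CommRing E] [CharP E p] [Algebra R E]

/-- The iterated Frobenius of an `R`-algebra as a semilinear map. -/
def frob (R : Type u) [CommRing R] [CharP R p] (E : Type u) [CommRing E] [CharP E p]
    [Algebra R E] (e : ℕ) : E →ₛₗ[iterateFrobenius R p e] E where
  toFun x := x ^ p ^ e
  map_add' x y := add_pow_char_pow ..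
  map_smul' r x := by
    rw [Algebra.smul_def, mul_pow, ← map_pow, iterateFrobenius_def, Algebra.smul_def]

/-- The iterated Frobenius of `E ⧸ P`, for a submodule `P` that is stable under Frobenius. -/
def frobQuot (P : Submodule R E) (e : ℕ) (hP : ∀ x ∈ P, x ^ p ^ e ∈ P) :
    (E ⧸ P) →ₛₗ[iterateFrobenius R p e] E ⧸ P :=
  P.mapQ P (frob p R E e) hP

theorem frobQuot_mk (P : Submodule R E) (e : ℕ) (hP : ∀ x ∈ P, x ^ p ^ e ∈ P) (x : E) :
    frobQuot p P e hP (Submodule.Quotient.mk x) = Submodule.Quotient.mk (x ^ p ^ e) := rfl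

omit [Fact p.Prime] [CharP R p] [CharP E p] in
theorem range_linearMap_pow (e : ℕ) (x : E) (hx : x ∈ LinearMap.range (Algebra.linearMap R E)) :
    x ^ p ^ e ∈ LinearMap.range (Algebra.linearMap R E) := by
  obtain ⟨r, rfl⟩ := hx
  exact ⟨r ^ p ^ e, by simp⟩

omit [CharP R p] in
theorem sup_pow {P Q : Submodule R E} {e : ℕ} (hP : ∀ x ∈ P, x ^ p ^ e ∈ P)
    (hQ : ∀ x ∈ Q, x ^ p ^ e ∈ Q) (x : E) (hx : x ∈ P ⊔ Q) : x ^ p ^ e ∈ P ⊔ Q := by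
  obtain ⟨a, ha, b, hb, rfl⟩ := Submodule.mem_sup.1 hx
  rw [add_pow_char_pow]
  exact Submodule.add_mem_sup (hP a ha) (hQ b hb)

/-- Frobenius as a morphism from `R → E → E ⧸ R` to its pushforward. -/
def frobCokerSeq (R : Type u) [CommRing R] [CharP R p] (E : Type u) [CommRing E] [CharP E p]
    [Algebra R E] (e : ℕ) : cokerSeq (Algebra.linearMap R E) ⟶
    (cokerSeq (Algebra.linearMap R E)).map (push (iterateFrobenius R p e)) :=
  ShortComplex.homMk (frobeniusToPushforward R p e) (toPush (frob p R E e))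
    (toPush (frobQuot p _ e (range_linearMap_pow p e)))
    (by
      ext
      change algebraMap R E (iterateFrobenius R p e 1) = (algebraMap R E 1) ^ p ^ e
      simp) (by ext x; rfl)

/-- Frobenius as a morphism from the Mayer–Vietoris sequence to its pushforward. -/
def frobMvSeq {P Q : Submodule R E} {e : ℕ} (hP : ∀ x ∈ P, x ^ p ^ e ∈ P)
    (hQ : ∀ x ∈ Q, x ^ p ^ e ∈ Q) : mvSeq P Q ⟶
    (mvSeq P Q).map (push (iterateFrobenius R p e)) :=
  ShortComplex.homMk (toPush (frobQuot p (P ⊓ Q) e fun x hx => ⟨hP x hx.1, hQ x hx.2⟩))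
    (toPush
      { toFun := fun x => (frobQuot p P e hP x.1, frobQuot p Q e hQ x.2)
        map_add' := fun x y => by simp
        map_smul' := fun r x => by simp [LinearMap.map_smulₛₗ] })
    (toPush (frobQuot p (P ⊔ Q) e (sup_pow p hP hQ)))
    (by
      ext x
      obtain ⟨x, rfl⟩ := Submodule.Quotient.mk_surjective _ x
      rfl)
    (by
      ext x
      obtain ⟨x, y⟩ := x
      obtain ⟨x, rfl⟩ := Submodule.Quotient.mk_surjective _ x
      obtain ⟨y, rfl⟩ := Submodule.Quotient.mk_surjective _ y
      change Submodule.Quotient.mk (x ^ p ^ e - y ^ p ^ e) = Submodule.Quotient.mk ((x - y) ^ p ^ e)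
      rw [sub_pow_char_pow])

theorem toPush_frobQuot_factor {P Q : Submodule R E} {e : ℕ} (h : P ≤ Q)
    (hP : ∀ x ∈ P, x ^ p ^ e ∈ P) (hQ : ∀ x ∈ Q, x ^ p ^ e ∈ Q) :
    toPush (frobQuot p P e hP) ≫ (push (iterateFrobenius R p e)).map
      (ModuleCat.ofHom (Submodule.factor h)) =
    ModuleCat.ofHom (Submodule.factor h) ≫ toPush (frobQuot p Q e hQ) := by
  ext x
  rfl

end Frobenius

/-! ### Low-degree local cohomology of a subring of a field -/

section Field

variable {R : Type u} [CommRing R] {J : Ideal R} {E : Type u} [Field E] [Algebra R E]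

theorem algebraMap_smul_bijective {t : R} (ht : algebraMap R E t ≠ 0) :
    Function.Bijective fun x : E => t • x := by
  simp only [Algebra.smul_def]
  exact mulLeft_bijective₀ _ ht

theorem smul_bijective_quot {t : R} (ht : algebraMap R E t ≠ 0) {P : Submodule R E}
    (hP : ∀ x, t • x ∈ P → x ∈ P) : Function.Bijective fun x : E ⧸ P => t • x := by
  constructor
  · refine (injective_iff_map_eq_zero (DistribSMul.toAddMonoidHom (E ⧸ P) t)).2 fun x hx => ?_
    obtain ⟨x, rfl⟩ := Submodule.Quotient.mk_surjective _ x
    rw [DistribSMul.toAddMonoidHom_apply, ← Submodule.Quotient.mk_smul,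
      Submodule.Quotient.mk_eq_zero] at hx
    exact (Submodule.Quotient.mk_eq_zero _).2 (hP x hx)
  · intro x
    obtain ⟨x, rfl⟩ := Submodule.Quotient.mk_surjective _ x
    obtain ⟨y, rfl⟩ := (algebraMap_smul_bijective ht).2 x
    exact ⟨Submodule.Quotient.mk y, rfl⟩

theorem mk_mem_powTorsion {P : Submodule R E} {x : E} :
    (Submodule.Quotient.mk x : E ⧸ P) ∈ powTorsion J (E ⧸ P) ↔
      ∃ m : ℕ, ∀ r ∈ J ^ m, r • x ∈ P := by
  simp only [mem_powTorsion, ← Submodule.Quotient.mk_smul, Submodule.Quotient.mk_eq_zero]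

end Field

theorem smul_eq_zero_of_smul_eq_zero {R : Type u} [CommRing R] {J : Ideal R} (i : ℕ)
    {M : ModuleCat.{u} R} {r : R} (hr : ∀ x : M, r • x = 0)
    (ξ : (localCohomology J i).obj M) : r • ξ = 0 := by
  have h : r • 𝟙 M = (0 : R) • 𝟙 M := by
    ext x
    exact (hr x).trans (zero_smul R x).symm
  rw [← map_smul_id, h, map_smul_id, zero_smul]

theorem exists_pow_smul_eq_zero_of_isNoetherian {R M : Type*} [CommRing R] [AddCommGroup M]
    [Module R M] [IsNoetherian R M] (t : R) (h : ∀ x : M, ∃ n : ℕ, t ^ n • x = 0) :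
    ∃ n : ℕ, ∀ x : M, t ^ n • x = 0 := by
  let N : ℕ →o Submodule R M :=
    ⟨fun n => LinearMap.ker (LinearMap.lsmul R M (t ^ n)), fun a b hab x hx => by
      rw [LinearMap.mem_ker, LinearMap.lsmul_apply] at hx ⊢
      rw [← Nat.sub_add_cancel hab, pow_add, mul_smul, hx, smul_zero]⟩
  obtain ⟨n, hn⟩ := monotone_stabilizes_iff_noetherian.2 ‹IsNoetherian R M› N
  refine ⟨n, fun x => ?_⟩
  obtain ⟨m, hm⟩ := h x
  have : x ∈ N (max n m) := N.monotone (le_max_right n m) hm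
  rw [← hn _ (le_max_left n m)] at this
  exact this

section Local

variable (R : Type u) [CommRing R] [IsLocalRing R] (p : ℕ) [Fact p.Prime] [CharP R p]
  (E : Type u) [Field E] [CharP E p] [Algebra R E]

/-- The image of `R` in `E`. -/
abbrev baseImage (R : Type u) [CommRing R] (E : Type u) [Field E] [Algebra R E] :
    Submodule R E :=
  LinearMap.range (Algebra.linearMap R E)

variable {R E}
variable (hinj : Function.Injective (algebraMap R E)) {t : R} (ht : t ∈ maximalIdeal R)
  (ht0 : t ≠ 0)
include hinj ht ht0

theorem eq_zero_field (i : ℕ)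
    (ξ : (localCohomology (maximalIdeal R) i).obj (ModuleCat.of R E)) : ξ = 0 :=
  eq_zero_of_bijective_smul i ht
    (algebraMap_smul_bijective ((map_ne_zero_iff _ hinj).2 ht0)) ξ

omit [CharP E p] in
theorem eq_zero_push_field (i e : ℕ) (ξ : (localCohomology (maximalIdeal R) i).obj
    ((push (iterateFrobenius R p e)).obj (ModuleCat.of R E))) : ξ = 0 :=
  eq_zero_of_push_bijective_smul _ i ht (algebraMap_smul_bijective (by
    rw [iterateFrobenius_def, map_pow]
    exact pow_ne_zero _ ((map_ne_zero_iff _ hinj).2 ht0))) ξ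

/-- `H^0_𝔪(R) = 0`. -/
theorem localCohomologyMax_zero_eq_zero (ξ : localCohomologyMax R 0) : ξ = 0 := by
  obtain ⟨⟨x, m, hx⟩, rfl⟩ := (ofPowTorsion_bijective (maximalIdeal R) (ModuleCat.of R R)).2 ξ
  have h : x = 0 := by
    apply hinj
    have := congrArg (algebraMap R E) (hx (t ^ m) (Ideal.pow_mem_pow ht m))
    rw [map_zero] at this
    rw [map_zero]
    change algebraMap R E (t ^ m * x) = 0 at this
    rw [map_mul, mul_eq_zero] at this
    refine this.resolve_left ?_
    rw [map_pow]
    exact pow_ne_zero _ ((map_ne_zero_iff _ hinj).2 ht0)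
  subst h
  exact map_zero _

omit ht ht0 in
/-- The connecting map `H^i_𝔪(E ⧸ R) → H^{i+1}_𝔪(R)`. -/
def baseConnecting (i : ℕ) :
    (localCohomology (maximalIdeal R) i).obj (ModuleCat.of R (E ⧸ baseImage R E)) →ₗ[R]
      localCohomologyMax R (i + 1) :=
  connecting (cokerSeq_shortExact (Algebra.linearMap R E) hinj) (maximalIdeal R) i

theorem baseConnecting_surjective (i : ℕ) :
    Function.Surjective (baseConnecting hinj i) := fun η =>
  connecting_surjective (cokerSeq_shortExact (Algebra.linearMap R E) hinj) i
    (fun ξ => eq_zero_field hinj ht ht0 _ ξ) η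

theorem baseConnecting_injective (i : ℕ) :
    Function.Injective (baseConnecting hinj i) :=
  connecting_injective (cokerSeq_shortExact (Algebra.linearMap R E) hinj) i
    fun ξ => eq_zero_field hinj ht ht0 _ ξ

/-- Through the connecting map, Frobenius on `H^{i+1}_𝔪(R)` is the map induced by `x ↦ x ^ (p ^ e)`
on `E ⧸ R`. -/
theorem frobeniusAction_baseConnecting_eq_zero_iff (i e : ℕ)
    (ξ : (localCohomology (maximalIdeal R) i).obj (ModuleCat.of R (E ⧸ baseImage R E))) :
    (frobeniusAction R p (i + 1) e).hom (baseConnecting hinj i ξ) = 0 ↔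
      ((localCohomology (maximalIdeal R) i).map
        (toPush (frobQuot p (baseImage R E) e (range_linearMap_pow p e)))).hom ξ = 0 := by
  have hS := cokerSeq_shortExact (Algebra.linearMap R E) hinj
  have hS' := push_shortExact (iterateFrobenius R p e) hS
  have h := connecting_naturality (J := maximalIdeal R) hS hS' (frobCokerSeq p R E e) i ξ
  have hi := connecting_injective (J := maximalIdeal R) hS' i
    fun ξ => eq_zero_push_field p hinj ht ht0 i e ξ
  exact (Eq.congr_left h).trans (map_eq_zero_iff _ hi)

/-- The class in `H^1_𝔪(R)` of an element `y` of `E` with `𝔪^n y ⊆ R` is killed by the `e`-th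
iterate of Frobenius if and only if `y ^ (p ^ e)` belongs to `R`. -/
theorem frobeniusAction_degree_one_iff (e : ℕ)
    (x : powTorsion (maximalIdeal R) (E ⧸ baseImage R E)) (y : E)
    (hy : Submodule.Quotient.mk y = x.1) :
    (frobeniusAction R p 1 e).hom (baseConnecting hinj 0
      (ofPowTorsion (maximalIdeal R) (ModuleCat.of R (E ⧸ baseImage R E)) x)) = 0 ↔
      y ^ p ^ e ∈ baseImage R E := by
  rw [frobeniusAction_baseConnecting_eq_zero_iff p hinj ht ht0 0 e]
  refine (map_ofPowTorsion_eq_zero_iff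
    (M := ModuleCat.of R (E ⧸ baseImage R E)) _ x).trans ?_
  change frobQuot p (baseImage R E) e (range_linearMap_pow p e) x.1 = 0 ↔ _
  rw [← hy, frobQuot_mk, Submodule.Quotient.mk_eq_zero]

end Local

section Cover

variable {R : Type u} [CommRing R] [IsLocalRing R] (p : ℕ) [Fact p.Prime] [CharP R p]
  {E : Type u} [Field E] [CharP E p] [Algebra R E]
  (hinj : Function.Injective (algebraMap R E)) {P Q : Submodule R E} {s t : R}

theorem iterateFrobenius_mem (e : ℕ) {r : R} (hr : r ∈ maximalIdeal R) :
    iterateFrobenius R p e r ∈ maximalIdeal R := by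
  rw [iterateFrobenius_def]
  exact Ideal.pow_mem_of_mem _ hr _ (pow_pos (Fact.out : p.Prime).pos _)

variable (hs : s ∈ maximalIdeal R) (hs0 : s ≠ 0) (hP : ∀ x, s • x ∈ P → x ∈ P)
  (ht : t ∈ maximalIdeal R) (ht0 : t ≠ 0) (hQ : ∀ x, t • x ∈ Q → x ∈ Q)

include hinj hs hs0 hP ht ht0 hQ in
theorem eq_zero_prod (i : ℕ) (ξ : (localCohomology (maximalIdeal R) i).obj
    (ModuleCat.of R ((E ⧸ P) × (E ⧸ Q)))) : ξ = 0 := by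
  let S : ShortComplex (ModuleCat.{u} R) :=
    ShortComplex.mk (ModuleCat.ofHom (LinearMap.inl R (E ⧸ P) (E ⧸ Q)))
      (ModuleCat.ofHom (LinearMap.snd R (E ⧸ P) (E ⧸ Q))) (by ext; rfl)
  have hS : S.ShortExact := shortExact_of_exact LinearMap.inl_injective LinearMap.snd_surjective
    Function.Exact.inl_snd
  have h1 := fun ξ => eq_zero_of_bijective_smul (M := ModuleCat.of R (E ⧸ P)) i hs
      (smul_bijective_quot ((map_ne_zero_iff _ hinj).2 hs0) hP) ξ
  have h2 := fun ξ => eq_zero_of_bijective_smul (M := ModuleCat.of R (E ⧸ Q)) i ht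
      (smul_bijective_quot ((map_ne_zero_iff _ hinj).2 ht0) hQ) ξ
  obtain ⟨η, rfl⟩ := exists_map_f_eq hS i ξ (h2 _)
  exact (congrArg _ (h1 η)).trans (map_zero _)

variable (hle : baseImage R E ≤ P ⊓ Q)
  (hm : ∀ r ∈ maximalIdeal R, ∀ x ∈ P ⊓ Q, r • x ∈ baseImage R E)

omit [CharP R p] [CharP E p] in
include hm in
theorem smul_ker_factor_eq_zero {r : R} (hr : r ∈ maximalIdeal R)
    (x : LinearMap.ker (Submodule.factor hle)) : r • x = 0 := by
  obtain ⟨x, hx⟩ := x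
  obtain ⟨x, rfl⟩ := Submodule.Quotient.mk_surjective _ x
  apply Subtype.ext
  change r • Submodule.Quotient.mk x = 0
  rw [← Submodule.Quotient.mk_smul, Submodule.Quotient.mk_eq_zero]
  exact hm r hr x ((Submodule.Quotient.mk_eq_zero _).1 hx)

include hm in
omit [CharP E p] in
/-- `H^1_𝔪(E ⧸ R) → H^1_𝔪(E ⧸ (P ∩ Q))` stays injective after Frobenius pushforward, because
`𝔪` kills `(P ∩ Q) ⧸ R`. -/
theorem map_factor_injective (e : ℕ) : Function.Injective
    ((localCohomology (maximalIdeal R) 1).map ((push (iterateFrobenius R p e)).map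
      (ModuleCat.ofHom (Submodule.factor hle)))).hom :=
  map_g_injective (push_shortExact (iterateFrobenius R p e)
    (kerSeq_shortExact (Submodule.factor hle) (Submodule.factor_surjective hle))) 1
    fun ξ => eq_zero_of_push_smul_eq_zero _ (M := ModuleCat.of R (LinearMap.ker _))
      (fun _ hr x => smul_ker_factor_eq_zero hle hm (iterateFrobenius_mem p e hr) x) ξ

variable (hPp : ∀ e, ∀ x ∈ P, x ^ p ^ e ∈ P) (hQp : ∀ e, ∀ x ∈ Q, x ^ p ^ e ∈ Q)

/-- The connecting map `H^0_𝔪(E ⧸ (P + Q)) → H^1_𝔪(E ⧸ (P ∩ Q))`. -/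
def mvConnecting (P Q : Submodule R E) :
    (localCohomology (maximalIdeal R) 0).obj (ModuleCat.of R (E ⧸ (P ⊔ Q))) →ₗ[R]
      (localCohomology (maximalIdeal R) 1).obj (ModuleCat.of R (E ⧸ (P ⊓ Q))) :=
  connecting (mvSeq_shortExact P Q) (maximalIdeal R) 0

include hinj hs hs0 hP ht ht0 hQ in
theorem mvConnecting_bijective : Function.Bijective (mvConnecting P Q) :=
  ⟨connecting_injective (mvSeq_shortExact P Q) 0
      fun ξ => eq_zero_prod hinj hs hs0 hP ht ht0 hQ 0 ξ,
    connecting_surjective (mvSeq_shortExact P Q) 0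
      fun ξ => eq_zero_prod hinj hs hs0 hP ht ht0 hQ 1 ξ⟩

theorem map_frob_mvConnecting_eq_zero (e : ℕ)
    (ξ : (localCohomology (maximalIdeal R) 0).obj (ModuleCat.of R (E ⧸ (P ⊔ Q))))
    (hξ : ((localCohomology (maximalIdeal R) 0).map
      (toPush (frobQuot p (P ⊔ Q) e (sup_pow p (hPp e) (hQp e))))).hom ξ = 0) :
    ((localCohomology (maximalIdeal R) 1).map
      (toPush (frobQuot p (P ⊓ Q) e fun x hx => ⟨hPp e x hx.1, hQp e x hx.2⟩))).hom
        (mvConnecting P Q ξ) = 0 := by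
  have hS := mvSeq_shortExact P Q
  have hS' := push_shortExact (iterateFrobenius R p e) hS
  have h := connecting_naturality (J := maximalIdeal R) hS hS' (frobMvSeq p (hPp e) (hQp e)) 0 ξ
  refine h.trans ?_
  exact (congrArg (connecting hS' (maximalIdeal R) 0) hξ).trans (map_zero _)

include hinj hs hs0 hP ht ht0 hQ hle hm hPp hQp in
/-- If the local sections of `E ⧸ (P + Q)` are `F`-nilpotent, then so is `H^2_𝔪(R)`. -/
theorem frobeniusNilpotentPart_two_eq_top
    (hw : ∀ w : E, (∃ m : ℕ, ∀ r ∈ maximalIdeal R ^ m, r • w ∈ P ⊔ Q) →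
      ∀ᶠ e in Filter.atTop, w ^ p ^ e ∈ P ⊔ Q) :
    frobeniusNilpotentPart R p 2 = ⊤ := by
  rw [eq_top_iff]
  rintro ξ -
  change ∀ᶠ e in Filter.atTop, (frobeniusAction R p 2 e).hom ξ = 0
  obtain ⟨ζ, rfl⟩ := baseConnecting_surjective hinj ht ht0 1 ξ
  obtain ⟨ω, hω⟩ := (mvConnecting_bijective hinj hs hs0 hP ht ht0 hQ).2
    (((localCohomology (maximalIdeal R) 1).map (ModuleCat.ofHom (Submodule.factor hle))).hom ζ)
  obtain ⟨⟨y, hy⟩, rfl⟩ := (ofPowTorsion_bijective _ _).2 ω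
  obtain ⟨w, rfl⟩ := Submodule.Quotient.mk_surjective _ y
  filter_upwards [hw w (mk_mem_powTorsion.1 hy)] with e he
  rw [frobeniusAction_baseConnecting_eq_zero_iff p hinj ht ht0 1 e]
  apply map_factor_injective p hle hm e
  rw [map_zero, ← ModuleCat.comp_apply, ← Functor.map_comp,
    toPush_frobQuot_factor p hle _ fun x hx => ⟨hPp e x hx.1, hQp e x hx.2⟩, Functor.map_comp,
    ModuleCat.comp_apply, ← hω]
  apply map_frob_mvConnecting_eq_zero p hPp hQp
  refine (map_ofPowTorsion_eq_zero_iff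
    (M := ModuleCat.of R (E ⧸ (P ⊔ Q))) _ ⟨Submodule.Quotient.mk w, hy⟩).2 ?_
  exact (Submodule.Quotient.mk_eq_zero _).2 he

include hinj hs hs0 hP ht ht0 hQ hle hm in
/-- If `E ⧸ (P + Q)` has local sections `w j` with `t w_{j+1} = w_j` and `w_0 ≠ 0`, then `H^2_𝔪(R)`
does not have finite length. -/
theorem not_isFiniteLength_two (w : ℕ → E)
    (hwm : ∀ j, ∃ m : ℕ, ∀ r ∈ maximalIdeal R ^ m, r • w j ∈ P ⊔ Q)
    (hws : ∀ j, t • w (j + 1) - w j ∈ P ⊔ Q) (hw0 : w 0 ∉ P ⊔ Q) :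
    ¬ IsFiniteLength R (localCohomologyMax R 2) := by
  intro hfin
  have := (isFiniteLength_iff_isNoetherian_isArtinian.1 hfin).1
  obtain ⟨n, hn⟩ := exists_pow_smul_eq_zero_of_isNoetherian (M := localCohomologyMax R 2) t
    fun ξ => by
      obtain ⟨m, hm⟩ := exists_pow_smul_eq_zero 2 ξ
      exact ⟨m, hm _ (Ideal.pow_mem_pow ht m)⟩
  let ω : ℕ → powTorsion (maximalIdeal R) (E ⧸ (P ⊔ Q)) := fun j =>
    ⟨Submodule.Quotient.mk (w j), mk_mem_powTorsion.2 (hwm j)⟩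
  let ζ : ℕ → (localCohomology (maximalIdeal R) 1).obj (ModuleCat.of R (E ⧸ (P ⊓ Q))) := fun j =>
    mvConnecting P Q (ofPowTorsion _ (ModuleCat.of R (E ⧸ (P ⊔ Q))) (ω j))
  have hω : ∀ j, t • ω (j + 1) = ω j := fun j =>
    Subtype.ext ((Submodule.Quotient.eq _).2 (hws j))
  have hζ : ∀ j, t • ζ (j + 1) = ζ j := fun j => by
    simp only [ζ, ← map_smul, hω]
  have hζn : ∀ j, t ^ j • ζ j = ζ 0 := fun j => by
    induction j with
    | zero => rw [pow_zero, one_smul]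
    | succ j ih => rw [pow_succ, mul_smul, hζ, ih]
  have hS := kerSeq_shortExact (Submodule.factor hle) (Submodule.factor_surjective hle)
  -- The obstruction to lifting `ζ j` to `E ⧸ R` is `t` times that of `ζ (j + 1)`, hence vanishes.
  have hobs : connecting hS (maximalIdeal R) 1 (ζ n) = 0 := by
    refine (congrArg _ (hζ n).symm).trans ((map_smul _ _ _).trans ?_)
    exact smul_eq_zero_of_smul_eq_zero (M := ModuleCat.of R (LinearMap.ker _)) 2
      (smul_ker_factor_eq_zero hle hm ht) _
  obtain ⟨η, hη⟩ := exists_map_g_eq hS 1 _ hobs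
  have hη0 : t ^ n • η = 0 := by
    apply baseConnecting_injective hinj ht ht0 1
    exact (map_smul _ _ _).trans ((hn _).trans (map_zero _).symm)
  have h0 : ζ 0 = 0 := by
    rw [← hζn n]
    refine (congrArg _ hη.symm).trans ((map_smul _ _ _).symm.trans ?_)
    exact (congrArg _ hη0).trans (map_zero _)
  have h1 : ω 0 = 0 := by
    apply (ofPowTorsion_bijective _ (ModuleCat.of R (E ⧸ (P ⊔ Q)))).1
    apply (mvConnecting_bijective hinj hs hs0 hP ht ht0 hQ).1
    rw [map_zero, map_zero]
    exact h0
  exact hw0 ((Submodule.Quotient.mk_eq_zero _).1 (congrArg Subtype.val h1))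

end Cover

end LocalCohomologyClass

/-! ### The hypotheses on `A` in terms of divisibility -/

/-- In a Noetherian local domain of depth at most one, not a field, the ring modulo some nonzero
element of the maximal ideal has a nonzero socle. -/
theorem exists_socle_of_localDepth_le_one {A : Type u} [CommRing A] [IsDomain A] [IsLocalRing A]
    [IsNoetherianRing A] (hA : ¬ IsField A) (hdepth : localDepth A ≤ 1) :
    ∃ a ∈ maximalIdeal A, a ≠ 0 ∧ ∃ c, ¬ a ∣ c ∧ ∀ b ∈ maximalIdeal A, a ∣ b * c := by
  obtain ⟨a, ha, ha0⟩ := (Submodule.ne_bot_iff _).1 (mt isField_iff_maximalIdeal_eq.2 hA)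
  refine ⟨a, ha, ha0, ?_⟩
  have hreg : ∀ b ∈ maximalIdeal A, ¬ IsSMulRegular (QuotSMulTop a A) b := by
    intro b hb h
    have hw : RingTheory.Sequence.IsWeaklyRegular A [a, b] := by
      rw [RingTheory.Sequence.isWeaklyRegular_cons_iff,
        RingTheory.Sequence.isWeaklyRegular_singleton_iff]
      exact ⟨fun x y hxy => mul_left_cancel₀ ha0 hxy, h⟩
    have hmem : ∀ r ∈ [a, b], r ∈ maximalIdeal A := by
      simpa using And.intro ha hb
    have hr := (IsLocalRing.isRegular_iff_isWeaklyRegular_of_subset_maximalIdeal hmem).2 hw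
    have h2 : ((2 : ℕ) : ℕ∞) ≤ localDepth A :=
      le_iSup₂_of_le [a, b] hr (le_iSup_of_le hmem le_rfl)
    exact absurd (h2.trans hdepth) (by decide)
  have hsub : (maximalIdeal A : Set A) ⊆ ⋃ P ∈ associatedPrimes A (QuotSMulTop a A), P := by
    intro b hb
    rw [biUnion_associatedPrimes_eq_compl_regular]
    exact hreg b hb
  obtain ⟨P, hP, hle⟩ := (Ideal.subset_union_prime_finite
    (associatedPrimes.finite A (QuotSMulTop a A)) (f := fun P => P) 0 0
    fun P hP _ _ => hP.isPrime).1 hsub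
  have hPp := hP.isPrime
  obtain ⟨x, hx⟩ := (Submodule.isAssociatedPrime_iff.1 hP).2
  obtain ⟨c, rfl⟩ := Submodule.Quotient.mk_surjective _ x
  have key : ∀ b : A, b ∈ P ↔ a ∣ b * c := by
    intro b
    rw [hx, Submodule.mem_colon_singleton, Submodule.mem_bot, ← Submodule.Quotient.mk_smul,
      Submodule.Quotient.mk_eq_zero, Submodule.mem_smul_pointwise_iff_exists]
    constructor
    · rintro ⟨y, -, hy⟩
      exact ⟨y, hy.symm⟩
    · rintro ⟨y, hy⟩
      exact ⟨y, trivial, hy.symm⟩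
  refine ⟨c, fun hc => hPp.ne_top ((Ideal.eq_top_iff_one _).2 ((key 1).2 ?_)),
    fun b hb => (key b).1 (hle hb)⟩
  rwa [one_mul]

/-- In a weakly `F`-nilpotent local domain of dimension at least two, an element `c / a` of the
fraction field that is multiplied into `A` by a power of the maximal ideal has a Frobenius power
in `A`. -/
theorem eventually_dvd_of_isWeaklyFNilpotent {A : Type u} [CommRing A] [IsDomain A] [IsLocalRing A]
    {p : ℕ} [Fact p.Prime] [CharP A p] (hdim : 1 < ringKrullDim A) (hA : IsWeaklyFNilpotent A p)
    {a c : A} (ha : a ≠ 0) (h : ∃ N : ℕ, ∀ b ∈ maximalIdeal A ^ N, a ∣ b * c) :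
    ∀ᶠ e in Filter.atTop, a ^ p ^ e ∣ c ^ p ^ e := by
  have hF : ¬ IsField A := fun hF => by
    rw [ringKrullDim_eq_zero_of_isField hF] at hdim
    exact absurd hdim (by decide)
  obtain ⟨t, ht, ht0⟩ := (Submodule.ne_bot_iff _).1 (mt isField_iff_maximalIdeal_eq.2 hF)
  let L := FractionRing A
  have hinj : Function.Injective (algebraMap A L) := IsFractionRing.injective A L
  have : CharP L p := charP_of_injective_algebraMap hinj p
  have ha' : algebraMap A L a ≠ 0 := (map_ne_zero_iff _ hinj).2 ha
  have key : ∀ (x y : A), x ≠ 0 → ((algebraMap A L y / algebraMap A L x ∈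
      LocalCohomologyClass.baseImage A L) ↔ x ∣ y) := by
    intro x y hx
    have hx' : algebraMap A L x ≠ 0 := (map_ne_zero_iff _ hinj).2 hx
    constructor
    · rintro ⟨z, hz⟩
      rw [Algebra.linearMap_apply, eq_div_iff hx', ← map_mul] at hz
      exact ⟨z, by rw [← hinj hz, mul_comm]⟩
    · rintro ⟨z, rfl⟩
      exact ⟨z, by rw [Algebra.linearMap_apply, map_mul, mul_div_cancel_left₀ _ hx']⟩
  have hx : (Submodule.Quotient.mk (algebraMap A L c / algebraMap A L a) :
      L ⧸ LocalCohomologyClass.baseImage A L) ∈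
        LocalCohomologyClass.powTorsion (maximalIdeal A) _ := by
    rw [LocalCohomologyClass.mk_mem_powTorsion]
    obtain ⟨N, hN⟩ := h
    refine ⟨N, fun r hr => ?_⟩
    rw [Algebra.smul_def, ← mul_div_assoc, ← map_mul, key _ _ ha]
    exact hN r hr
  have htop := hA 1 (by exact_mod_cast hdim)
  have hmem : LocalCohomologyClass.baseConnecting hinj 0
      (LocalCohomologyClass.ofPowTorsion (maximalIdeal A)
        (ModuleCat.of A (L ⧸ LocalCohomologyClass.baseImage A L)) ⟨_, hx⟩) ∈
        frobeniusNilpotentPart A p 1 := by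
    rw [htop]
    trivial
  filter_upwards [show ∀ᶠ e in Filter.atTop, _ from hmem] with e he
  have := (LocalCohomologyClass.frobeniusAction_degree_one_iff p hinj ht ht0 e ⟨_, hx⟩ _ rfl).1 he
  rwa [div_pow, ← map_pow, ← map_pow, key _ _ (pow_ne_zero _ ha)] at this

/-! ### Polynomials with unit values at `0` and `1` -/

namespace GluedPoints
open Polynomial LocalCohomologyClass

section UnitPoly

variable (A : Type u) [CommRing A]

/-- The polynomial `T (T - 1)`. -/
def tPoly : A[X] := X * (X - 1)

/-- The polynomials whose values at `0` and `1` are units. -/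
def unitPoly : Submonoid A[X] where
  carrier := {g | IsUnit (g.eval 0) ∧ IsUnit (g.eval 1)}
  mul_mem' := fun ha hb => by
    rw [Set.mem_ofPred_eq, eval_mul, eval_mul]
    exact ⟨ha.1.mul hb.1, ha.2.mul hb.2⟩
  one_mem' := by simp

variable {A}

theorem tPoly_monic : (tPoly A).Monic := by
  have : (X - 1 : A[X]) = X - C 1 := by simp
  rw [tPoly, this]
  exact monic_X.mul (monic_X_sub_C 1)

theorem degree_tPoly [Nontrivial A] : (tPoly A).degree = 2 := by
  have : (X - 1 : A[X]) = X - C 1 := by simp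
  rw [tPoly, this, Monic.degree_mul (monic_X_sub_C 1), degree_X, degree_X_sub_C]
  rfl

theorem isCoprime_of_isUnit_eval {g : A[X]} {x : A} (h : IsUnit (g.eval x)) :
    IsCoprime g (X - C x) := by
  obtain ⟨q, hq⟩ := X_sub_C_dvd_sub_C_eval (p := g) (a := x)
  obtain ⟨u, hu⟩ := h.exists_left_inv
  refine ⟨C u, -C u * q, ?_⟩
  have : C u * C (g.eval x) = 1 := by rw [← C_mul, hu, C_1]
  linear_combination C u * hq + this

theorem isCoprime_tPoly_pow {g : A[X]} (hg : g ∈ unitPoly A) (n : ℕ) :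
    IsCoprime g (tPoly A ^ n) := by
  have h0 := isCoprime_of_isUnit_eval hg.1
  have h1 := isCoprime_of_isUnit_eval hg.2
  rw [C_0, sub_zero] at h0
  rw [C_1] at h1
  exact (h0.mul_right h1).pow_right

theorem dvd_of_monic_dvd_C_mul [IsDomain A] {q f : A[X]} (hq : q.Monic) {a : A} (ha : a ≠ 0)
    (h : q ∣ C a * f) : q ∣ f := by
  rw [← modByMonic_eq_zero_iff_dvd hq] at h ⊢
  rw [← smul_eq_C_mul, smul_modByMonic, smul_eq_zero] at h
  exact h.resolve_left ha

theorem C_dvd_of_C_dvd_mul_monic [IsDomain A] {q h : A[X]} (hq : q.Monic) {a : A} (ha : a ≠ 0)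
    (hd : C a ∣ h * q) : C a ∣ h := by
  obtain ⟨f, hf⟩ := hd
  obtain ⟨f', rfl⟩ := dvd_of_monic_dvd_C_mul hq ha ⟨h, by rw [← hf, mul_comm]⟩
  exact ⟨f', mul_right_cancel₀ hq.ne_zero (by rw [hf]; ring)⟩

/-- Constants and polynomials with unit values at `0` and `1` are nonzerodivisors modulo the powers
of `T (T - 1)`. -/
theorem tPoly_pow_dvd [IsDomain A] {g f : A[X]} {a : A} {n : ℕ} (ha : a ≠ 0) (hg : g ∈ unitPoly A)
    (h : tPoly A ^ n ∣ C a * (g * f)) : tPoly A ^ n ∣ f :=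
  (isCoprime_tPoly_pow hg n).symm.dvd_of_dvd_mul_left
    (dvd_of_monic_dvd_C_mul (tPoly_monic.pow n) ha h)

/-- If `h` is congruent to a multiple of `a` modulo a monic polynomial of larger degree, then `a`
divides `h`. -/
theorem C_dvd_of_dvd_sub [IsDomain A] {q f h : A[X]} (hq : q.Monic) {a : A}
    (hdeg : h.degree < q.degree) (hd : q ∣ h - C a * f) : C a ∣ h := by
  rw [← modByMonic_eq_zero_iff_dvd hq, sub_modByMonic, (modByMonic_eq_self_iff hq).2 hdeg,
    ← smul_eq_C_mul, smul_modByMonic, sub_eq_zero] at hd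
  rw [hd, smul_eq_C_mul]
  exact dvd_mul_right _ _

/-- The Frobenius powers of a polynomial are computed coefficientwise. -/
theorem C_pow_dvd_pow {p : ℕ} [Fact p.Prime] [CharP A p] {a : A} {h : A[X]} {e : ℕ}
    (hd : ∀ i ∈ h.support, a ^ p ^ e ∣ h.coeff i ^ p ^ e) : C a ^ p ^ e ∣ h ^ p ^ e := by
  conv_rhs => rw [h.as_sum_support_C_mul_X_pow]
  rw [sum_pow_char_pow]
  refine Finset.dvd_sum fun i hi => ?_
  rw [mul_pow, ← C_pow, ← C_pow]
  exact Dvd.dvd.mul_right (map_dvd C (hd i hi)) _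

end UnitPoly

/-! ### The glued ring and its localization inside a field -/

section Glued

variable {A : Type u} [CommRing A] [IsLocalRing A]

theorem mem_glued {f : A[X]} :
    f ∈ gluedSubalgebra A ↔ f.eval 0 - f.eval 1 ∈ maximalIdeal A := by
  change residue A (f.eval 0) = residue A (f.eval 1) ↔ _
  rw [← sub_eq_zero, ← map_sub, residue_eq_zero_iff]

theorem eval_one_mem {f : A[X]} (hf : f ∈ gluedSubalgebra A) :
    f.eval 1 ∈ maximalIdeal A ↔ f.eval 0 ∈ maximalIdeal A := by
  have h := mem_glued.1 hf
  exact ⟨fun h1 => by simpa using add_mem h h1, fun h0 => by simpa using sub_mem h0 h⟩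

theorem mem_unitPoly_of_mem_glued {g : A[X]} (hg : g ∈ gluedSubalgebra A)
    (h0 : IsUnit (g.eval 0)) : g ∈ unitPoly A := by
  refine ⟨h0, ?_⟩
  by_contra h1
  exact (mem_maximalIdeal _).1 ((eval_one_mem hg).1 ((mem_maximalIdeal _).2 h1)) h0

theorem mem_glued_of_eval_mem {f : A[X]} (h0 : f.eval 0 ∈ maximalIdeal A)
    (h1 : f.eval 1 ∈ maximalIdeal A) : f ∈ gluedSubalgebra A :=
  mem_glued.2 (sub_mem h0 h1)

omit [IsLocalRing A] in
theorem tPoly_eval_zero : (tPoly A).eval 0 = 0 := by simp [tPoly]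

omit [IsLocalRing A] in
theorem tPoly_eval_one : (tPoly A).eval 1 = 0 := by simp [tPoly]

/-- Every polynomial with unit values at `0` and `1` has a multiple with equal unit values at `0`
and `1`. -/
theorem exists_mul_mem_glued {g : A[X]} (hg : g ∈ unitPoly A) :
    ∃ g' : A[X], g' * g ∈ gluedSubalgebra A ∧ IsUnit ((g' * g).eval 0) := by
  refine ⟨C (g.eval 1) + C (g.eval 0 - g.eval 1) * X, mem_glued.2 ?_, ?_⟩
  · simp [mul_comm]
  · simpa using hg.2.mul hg.1

end Glued

section

variable (A : Type u) [CommRing A] [IsLocalRing A] (R : Type u) [CommRing R]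
  [IsLocalRing R] (E : Type u) [Field E] [Algebra A[X] E] [Algebra R E]

/-- The image of `R` in the field `E` is the localization of the glued ring at the conductor,
and the maximal ideal of `R` consists of the fractions whose numerator vanishes at the glued
point. Since the values at `0` and `1` of an element of the glued ring agree modulo the maximal
ideal of `A`, the conditions on denominators and numerators only refer to the value at `0`. -/
structure IsGluedLocalization : Prop where
  exists_frac : ∀ r : R, ∃ f ∈ gluedSubalgebra A, ∃ g ∈ gluedSubalgebra A,
    IsUnit (g.eval 0) ∧ algebraMap A[X] E g * algebraMap R E r = algebraMap A[X] E f ∧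
      (r ∈ maximalIdeal R → f.eval 0 ∈ maximalIdeal A)
  exists_eq : ∀ f ∈ gluedSubalgebra A, ∀ g ∈ gluedSubalgebra A, IsUnit (g.eval 0) →
    ∃ r : R, algebraMap A[X] E g * algebraMap R E r = algebraMap A[X] E f ∧
      (f.eval 0 ∈ maximalIdeal A → r ∈ maximalIdeal R)

variable {A R E}

theorem IsGluedLocalization.exists_eq_algebraMap (H : IsGluedLocalization A R E) {f : A[X]}
    (hf : f ∈ gluedSubalgebra A) : ∃ r : R, algebraMap R E r = algebraMap A[X] E f ∧
      (f.eval 0 ∈ maximalIdeal A → r ∈ maximalIdeal R) := by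
  obtain ⟨r, hr, h⟩ := H.exists_eq f hf 1 (one_mem _) (by simp)
  exact ⟨r, by simpa using hr, h⟩

/-- The `R`-submodule of `E` of fractions of polynomials with denominators in `M`, where `M`
contains the polynomials with unit values at `0` and `1`. -/
def fracSub (H : IsGluedLocalization A R E) (M : Submonoid A[X]) (hM : unitPoly A ≤ M) :
    Submodule R E where
  carrier := {x | ∃ d ∈ M, ∃ f, algebraMap A[X] E d * x = algebraMap A[X] E f}
  add_mem' := by
    rintro x y ⟨d, hd, f, h⟩ ⟨d', hd', f', h'⟩
    refine ⟨d * d', mul_mem hd hd', d' * f + d * f', ?_⟩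
    simp only [map_mul, map_add]
    linear_combination algebraMap A[X] E d' * h + algebraMap A[X] E d * h'
  zero_mem' := ⟨1, one_mem _, 0, by simp⟩
  smul_mem' := by
    rintro r x ⟨d, hd, f, h⟩
    obtain ⟨f', hf', g, hg, hg0, h', -⟩ := H.exists_frac r
    refine ⟨g * d, mul_mem (hM (mem_unitPoly_of_mem_glued hg hg0)) hd, f' * f, ?_⟩
    rw [Algebra.smul_def]
    simp only [map_mul]
    linear_combination algebraMap A[X] E d * x * h' + algebraMap A[X] E f' * h

theorem pow_mem_fracSub {H : IsGluedLocalization A R E} {M : Submonoid A[X]} {hM : unitPoly A ≤ M}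
    {x : E} (n : ℕ) (hx : x ∈ fracSub H M hM) : x ^ n ∈ fracSub H M hM := by
  obtain ⟨d, hd, f, h⟩ := hx
  exact ⟨d ^ n, pow_mem hd n, f ^ n, by rw [map_pow, map_pow, ← mul_pow, h]⟩

theorem baseImage_le_fracSub (H : IsGluedLocalization A R E) (M : Submonoid A[X])
    (hM : unitPoly A ≤ M) : baseImage R E ≤ fracSub H M hM := by
  rintro _ ⟨r, rfl⟩
  obtain ⟨f, hf, g, hg, hg0, h, -⟩ := H.exists_frac r
  exact ⟨g, hM (mem_unitPoly_of_mem_glued hg hg0), f, h⟩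

theorem mem_fracSub_of_mul {H : IsGluedLocalization A R E} {M : Submonoid A[X]}
    {hM : unitPoly A ≤ M} {d : A[X]} (hd : d ∈ M) {x : E}
    (hx : algebraMap A[X] E d * x ∈ fracSub H M hM) : x ∈ fracSub H M hM := by
  obtain ⟨d', hd', f, h⟩ := hx
  exact ⟨d' * d, mul_mem hd' hd, f, by rw [← h, map_mul, mul_assoc]⟩

variable (A) in
/-- The denominators `T^n (T - 1)^n g`, where `g` has unit values at `0` and `1`. -/
def tDenoms : Submonoid A[X] := Submonoid.powers (tPoly A) ⊔ unitPoly A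

variable (A) in
/-- The denominators `a g`, where `a` is a nonzero constant and `g` has unit values at `0`
and `1`. -/
def cDenoms : Submonoid A[X] := (nonZeroDivisors A).map (C : A →+* A[X]) ⊔ unitPoly A

omit [IsLocalRing A] in
theorem mem_tDenoms {d : A[X]} :
    d ∈ tDenoms A ↔ ∃ n : ℕ, ∃ g ∈ unitPoly A, tPoly A ^ n * g = d := by
  rw [tDenoms, Submonoid.mem_sup]
  constructor
  · rintro ⟨_, ⟨n, rfl⟩, g, hg, h⟩
    exact ⟨n, g, hg, h⟩
  · rintro ⟨n, g, hg, h⟩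
    exact ⟨_, ⟨n, rfl⟩, g, hg, h⟩

theorem mem_cDenoms [IsDomain A] {d : A[X]} :
    d ∈ cDenoms A ↔ ∃ a : A, a ≠ 0 ∧ ∃ g ∈ unitPoly A, C a * g = d := by
  rw [cDenoms, Submonoid.mem_sup]
  constructor
  · rintro ⟨_, ⟨a, ha, rfl⟩, g, hg, h⟩
    exact ⟨a, nonZeroDivisors.ne_zero ha, g, hg, h⟩
  · rintro ⟨a, ha, g, hg, h⟩
    exact ⟨_, ⟨a, mem_nonZeroDivisors_of_ne_zero ha, rfl⟩, g, hg, h⟩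

/-- The fractions with denominator `T^n (T - 1)^n g`. -/
abbrev tFrac (H : IsGluedLocalization A R E) : Submodule R E := fracSub H (tDenoms A) le_sup_right

/-- The fractions with denominator `a g`. -/
abbrev cFrac (H : IsGluedLocalization A R E) : Submodule R E := fracSub H (cDenoms A) le_sup_right

omit [IsLocalRing A] in
theorem tPoly_mem_tDenoms : tPoly A ∈ tDenoms A := mem_tDenoms.2 ⟨1, 1, one_mem _, by simp⟩

theorem C_mem_cDenoms [IsDomain A] {a : A} (ha : a ≠ 0) : C a ∈ cDenoms A :=
  mem_cDenoms.2 ⟨a, ha, 1, one_mem _, by simp⟩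

variable [IsDomain A] [IsFractionRing A[X] E]

omit [IsDomain A] in
theorem algebraMap_unitPoly_ne_zero {g : A[X]} (hg : g ∈ unitPoly A) : algebraMap A[X] E g ≠ 0 := by
  refine (map_ne_zero_iff _ (IsFractionRing.injective A[X] E)).2 ?_
  rintro rfl
  simpa using hg.1

omit [IsDomain A] in
theorem algebraMap_tPoly_ne_zero : algebraMap A[X] E (tPoly A) ≠ 0 :=
  (map_ne_zero_iff _ (IsFractionRing.injective A[X] E)).2 tPoly_monic.ne_zero

omit [IsLocalRing A] [IsDomain A] in
theorem algebraMap_C_ne_zero {a : A} (ha : a ≠ 0) : algebraMap A[X] E (C a) ≠ 0 :=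
  (map_ne_zero_iff _ (IsFractionRing.injective A[X] E)).2 (C_ne_zero.2 ha)

/-- The fractions that belong to both `tFrac` and `cFrac` have denominators with unit values at `0`
and `1`: the constants and `T (T - 1)` form a regular sequence. -/
theorem tFrac_inf_cFrac (H : IsGluedLocalization A R E) :
    tFrac H ⊓ cFrac H = fracSub H (unitPoly A) le_rfl := by
  apply le_antisymm
  · rintro x ⟨⟨d, hd, f, h⟩, ⟨d', hd', f', h'⟩⟩
    obtain ⟨n, g, hg, rfl⟩ := mem_tDenoms.1 hd
    obtain ⟨a, ha, g', hg', rfl⟩ := mem_cDenoms.1 hd'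
    have e : C a * (g' * f) = tPoly A ^ n * (g * f') := by
      apply IsFractionRing.injective A[X] E
      simp only [map_mul, map_pow] at h h' ⊢
      linear_combination - algebraMap A[X] E (C a) * algebraMap A[X] E g' * h
        + algebraMap A[X] E (tPoly A) ^ n * algebraMap A[X] E g * h'
    obtain ⟨f1, rfl⟩ := tPoly_pow_dvd ha hg' ⟨_, e⟩
    refine ⟨g, hg, f1, mul_left_cancel₀ (pow_ne_zero n (algebraMap_tPoly_ne_zero (A := A))) ?_⟩
    rw [← mul_assoc, ← map_pow, ← map_mul, h, map_mul]
  · rintro x ⟨g, hg, f, h⟩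
    exact ⟨⟨g, le_sup_right (α := Submonoid A[X]) hg, f, h⟩,
      ⟨g, le_sup_right (α := Submonoid A[X]) hg, f, h⟩⟩

/-- The maximal ideal of `R` multiplies the semilocalization of `A[T]` at the two glued points into
`R`: a product of a polynomial that vanishes at both points with any polynomial is in the glued
ring. -/
theorem smul_mem_baseImage (H : IsGluedLocalization A R E) {r : R} (hr : r ∈ maximalIdeal R) {x : E}
    (hx : x ∈ tFrac H ⊓ cFrac H) : r • x ∈ baseImage R E := by
  rw [tFrac_inf_cFrac] at hx
  obtain ⟨g, hg, f, h⟩ := hx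
  obtain ⟨f0, hf0, g0, hg0, hu, h0, hm⟩ := H.exists_frac r
  have hm := hm hr
  obtain ⟨g', hg', hu'⟩ := exists_mul_mem_glued hg
  have hnum : f0 * (g' * f) ∈ gluedSubalgebra A := by
    refine mem_glued_of_eval_mem ?_ ?_
    · rw [eval_mul]; exact Ideal.mul_mem_right _ _ hm
    · rw [eval_mul]; exact Ideal.mul_mem_right _ _ ((eval_one_mem hf0).2 hm)
  obtain ⟨s, hs, -⟩ := H.exists_eq _ hnum (g0 * (g' * g)) (mul_mem hg0 hg') (by
    rw [eval_mul]; exact hu.mul hu')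
  refine ⟨s, mul_left_cancel₀ (algebraMap_unitPoly_ne_zero (E := E) (mul_mem
    (mem_unitPoly_of_mem_glued hg0 hu) (mem_unitPoly_of_mem_glued hg' hu'))) ?_⟩
  rw [Algebra.linearMap_apply, hs, Algebra.smul_def]
  simp only [map_mul]
  linear_combination - algebraMap A[X] E g' * algebraMap A[X] E g * x * h0
    - algebraMap A[X] E f0 * algebraMap A[X] E g' * h

/-- An element `h / (a t^N)` with `deg h < 2 N` is a sum of elements of `tFrac` and `cFrac` only if
`a` divides `h`. -/
theorem C_dvd_of_mem_sup (H : IsGluedLocalization A R E) {a : A} (ha : a ≠ 0) {N : ℕ} {h : A[X]}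
    (hdeg : h.degree < (tPoly A ^ N).degree) {y : E}
    (hy : algebraMap A[X] E (C a * tPoly A ^ N) * y = algebraMap A[X] E h)
    (hmem : y ∈ tFrac H ⊔ cFrac H) : C a ∣ h := by
  obtain ⟨y1, ⟨d, hd, f, h1⟩, y2, ⟨d', hd', f', h2⟩, rfl⟩ := Submodule.mem_sup.1 hmem
  obtain ⟨n, g, hg, rfl⟩ := mem_tDenoms.1 hd
  obtain ⟨b, hb, g', hg', rfl⟩ := mem_cDenoms.1 hd'
  have e : C b * (g' * (g * (h * tPoly A ^ n) - C a * (f * tPoly A ^ N))) =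
      tPoly A ^ (N + n) * (C a * g * f') := by
    apply IsFractionRing.injective A[X] E
    simp only [map_mul, map_pow, map_sub] at h1 h2 hy ⊢
    rw [pow_add, ← hy]
    linear_combination algebraMap A[X] E (C b) * algebraMap A[X] E g' * algebraMap A[X] E (C a) *
      algebraMap A[X] E (tPoly A) ^ N * h1
      + algebraMap A[X] E (tPoly A) ^ N * algebraMap A[X] E (tPoly A) ^ n *
      algebraMap A[X] E (C a) * algebraMap A[X] E g * h2
  obtain ⟨q, hq⟩ := tPoly_pow_dvd hb hg' ⟨_, e⟩
  -- Inverting `g` modulo `t ^ (N + n)` shows that `h t ^ n` is a multiple of `a` modulo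
  -- `t ^ (N + n)`, where its degree is less than that of `t ^ (N + n)`.
  obtain ⟨u, v, huv⟩ := isCoprime_tPoly_pow hg (N + n)
  have hdvd : tPoly A ^ (N + n) ∣ h * tPoly A ^ n - C a * (u * f * tPoly A ^ N) :=
    ⟨u * q + v * (h * tPoly A ^ n), by
      linear_combination u * hq - h * tPoly A ^ n * huv⟩
  refine C_dvd_of_C_dvd_mul_monic (tPoly_monic.pow n) ha
    (C_dvd_of_dvd_sub (tPoly_monic.pow (N + n)) ?_ hdvd)
  rw [pow_add, (tPoly_monic.pow n).degree_mul, (tPoly_monic.pow n).degree_mul]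
  exact WithBot.add_lt_add_right (degree_ne_bot.2 (tPoly_monic.pow n).ne_zero) hdeg

end

section

variable {A : Type u} [CommRing A] [IsLocalRing A] {R : Type u} [CommRing R]
  [IsLocalRing R] {E : Type u} [Field E] [Algebra A[X] E] [Algebra R E]

theorem IsGluedLocalization.exists_mem_pow (H : IsGluedLocalization A R E) (N : ℕ) {b : A}
    (hb : b ∈ maximalIdeal A ^ N) :
    ∃ r ∈ maximalIdeal R ^ N, algebraMap R E r = algebraMap A[X] E (C b) := by
  induction N generalizing b with
  | zero =>
    obtain ⟨r, hr, -⟩ := H.exists_eq_algebraMap (f := C b) (mem_glued.2 (by simp))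
    exact ⟨r, by simp, hr⟩
  | succ N ih =>
    rw [pow_succ] at hb
    refine Submodule.mul_induction_on hb (fun x hx y hy => ?_) fun x y hx hy => ?_
    · obtain ⟨r, hr, h⟩ := ih hx
      obtain ⟨s, hs, hm⟩ := H.exists_eq_algebraMap (f := C y) (mem_glued.2 (by simp))
      refine ⟨r * s, ?_, by rw [map_mul, h, hs, C_mul, map_mul]⟩
      rw [pow_succ]
      exact Ideal.mul_mem_mul hr (hm (by simpa using hy))
    · obtain ⟨r, hr, h⟩ := hx
      obtain ⟨s, hs, h'⟩ := hy
      exact ⟨r + s, add_mem hr hs, by rw [map_add, h, h', C_add, map_add]⟩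

theorem IsGluedLocalization.exists_tPoly (H : IsGluedLocalization A R E) :
    ∃ t ∈ maximalIdeal R, algebraMap R E t = algebraMap A[X] E (tPoly A) := by
  obtain ⟨t, ht, hm⟩ := H.exists_eq_algebraMap (f := tPoly A) (mem_glued.2 (by
    simp [tPoly_eval_zero, tPoly_eval_one]))
  exact ⟨t, hm (by simp [tPoly_eval_zero]), ht⟩

theorem IsGluedLocalization.exists_C (H : IsGluedLocalization A R E) {a : A}
    (ha : a ∈ maximalIdeal A) :
    ∃ s ∈ maximalIdeal R, algebraMap R E s = algebraMap A[X] E (C a) := by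
  simpa using H.exists_mem_pow 1 (b := a) (by simpa using ha)

variable [IsDomain A] [IsFractionRing A[X] E]

/-! ### The local sections of `E ⧸ (tFrac + cFrac)` -/

/-- Modulo `tFrac` and `cFrac`, every element that is moved into their sum by a power of
`T (T - 1)` is of the form `h / (a (T (T - 1))^N)`, where the degree of `h` is less than `2 N`. -/
theorem exists_normal_form (H : IsGluedLocalization A R E) {w : E} {N : ℕ}
    (hw : algebraMap A[X] E (tPoly A ^ N) * w ∈ tFrac H ⊔ cFrac H) :
    ∃ (a : A) (h : A[X]) (y : E), a ≠ 0 ∧ h.degree < (tPoly A ^ N).degree ∧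
      algebraMap A[X] E (C a * tPoly A ^ N) * y = algebraMap A[X] E h ∧
        w - y ∈ tFrac H ⊔ cFrac H := by
  obtain ⟨s1, hs1, s2, ⟨d, hd, f, hf⟩, hs⟩ := Submodule.mem_sup.1 hw
  obtain ⟨a, ha, g, hg, rfl⟩ := mem_cDenoms.1 hd
  -- As `1 = u g + v t ^ N`, the element `f / (a g t ^ N)` is `f u / (a t ^ N) + f v / (a g)`.
  obtain ⟨u, v, huv⟩ := isCoprime_tPoly_pow hg N
  have ht : algebraMap A[X] E (tPoly A ^ N) ≠ 0 := by
    rw [map_pow]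
    exact pow_ne_zero _ algebraMap_tPoly_ne_zero
  have hat : algebraMap A[X] E (C a * tPoly A ^ N) ≠ 0 := by
    rw [map_mul]
    exact mul_ne_zero (algebraMap_C_ne_zero ha) ht
  have hdiv := modByMonic_add_div (f * u) (tPoly A ^ N)
  set h := (f * u) %ₘ (tPoly A ^ N)
  set k := (f * u) /ₘ (tPoly A ^ N)
  have hw1 : s1 / algebraMap A[X] E (tPoly A ^ N) ∈ tFrac H := by
    refine mem_fracSub_of_mul (pow_mem tPoly_mem_tDenoms N) ?_
    rwa [mul_div_cancel₀ _ ht]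
  refine ⟨a, h, algebraMap A[X] E h / algebraMap A[X] E (C a * tPoly A ^ N), ha,
    degree_modByMonic_lt _ (tPoly_monic.pow N), mul_div_cancel₀ _ hat, ?_⟩
  set y := algebraMap A[X] E h / algebraMap A[X] E (C a * tPoly A ^ N) with hy
  rw [eq_div_iff hat] at hy
  set w1 := s1 / algebraMap A[X] E (tPoly A ^ N) with hw1'
  rw [eq_div_iff ht] at hw1'
  have hw2 : w - w1 - y ∈ cFrac H := by
    refine ⟨C a * g, hd, f * v + g * k, mul_left_cancel₀ ht ?_⟩
    have e1 := congrArg (algebraMap A[X] E) hdiv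
    have e2 := congrArg (algebraMap A[X] E) huv
    simp only [map_mul, map_add, map_one] at e1 e2 hf hy hw1' hs ⊢
    linear_combination - algebraMap A[X] E (C a) * algebraMap A[X] E g * hs
      - algebraMap A[X] E (C a) * algebraMap A[X] E g * hw1' + hf
      - algebraMap A[X] E g * hy - algebraMap A[X] E g * e1 - algebraMap A[X] E f * e2
  have e : w - y = w1 + (w - w1 - y) := by ring
  rw [e]
  exact Submodule.add_mem_sup hw1 hw2

/-- If the fractions `c / a` that a power of the maximal ideal of `A` multiplies into `A` have
Frobenius powers in `A`, then the local sections of `E ⧸ (tFrac + cFrac)` are `F`-nilpotent. -/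
theorem eventually_pow_mem_sup (H : IsGluedLocalization A R E) {p : ℕ} [Fact p.Prime] [CharP A p]
    [CharP E p]
    (hA : ∀ a c : A, a ≠ 0 → (∃ N : ℕ, ∀ b ∈ maximalIdeal A ^ N, a ∣ b * c) →
      ∀ᶠ e in Filter.atTop, a ^ p ^ e ∣ c ^ p ^ e) (w : E)
    (hw : ∃ N : ℕ, ∀ r ∈ maximalIdeal R ^ N, r • w ∈ tFrac H ⊔ cFrac H) :
    ∀ᶠ e in Filter.atTop, w ^ p ^ e ∈ tFrac H ⊔ cFrac H := by
  obtain ⟨N, hN⟩ := hw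
  obtain ⟨t, ht, ht'⟩ := H.exists_tPoly
  have htN : algebraMap A[X] E (tPoly A ^ N) * w ∈ tFrac H ⊔ cFrac H := by
    have := hN _ (Ideal.pow_mem_pow ht N)
    rwa [Algebra.smul_def, map_pow, ht', ← map_pow] at this
  obtain ⟨a, h, y, ha, hdeg, hy, hwy⟩ := exists_normal_form H htN
  have hdvd : ∀ i, ∀ b ∈ maximalIdeal A ^ N, a ∣ b * h.coeff i := by
    intro i b hb
    obtain ⟨r, hr, hrb⟩ := H.exists_mem_pow N hb
    have hmem : r • y ∈ tFrac H ⊔ cFrac H := by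
      have := sub_mem (hN r hr) (Submodule.smul_mem _ r hwy)
      rwa [← smul_sub, sub_sub_cancel] at this
    have := C_dvd_of_mem_sup H ha (h := C b * h) (N := N) ((degree_mul_le _ _).trans_lt ?_) ?_ hmem
    · rw [← coeff_C_mul]
      exact (C_dvd_iff_dvd_coeff _ _).1 this i
    · refine lt_of_le_of_lt ?_ hdeg
      exact (add_le_add_left degree_C_le _).trans (zero_add _).le
    · rw [Algebra.smul_def, hrb, map_mul (algebraMap A[X] E) (C b), ← hy]
      ring
  have hev : ∀ᶠ e in Filter.atTop, ∀ i ∈ h.support, a ^ p ^ e ∣ h.coeff i ^ p ^ e :=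
    (Finset.eventually_all _).2 fun i _ => hA a _ ha ⟨N, hdvd i⟩
  filter_upwards [hev] with e he
  obtain ⟨k, hk⟩ := C_pow_dvd_pow he
  have hye : y ^ p ^ e ∈ tFrac H := by
    refine ⟨(tPoly A ^ N) ^ p ^ e, pow_mem (pow_mem tPoly_mem_tDenoms N) _, k, ?_⟩
    apply mul_left_cancel₀ (pow_ne_zero (p ^ e) (algebraMap_C_ne_zero (E := E) ha))
    rw [← map_pow, ← map_mul, ← hk, map_pow _ h, ← hy]
    simp only [map_mul, map_pow]
    ring
  have e1 : w ^ p ^ e = (w - y) ^ p ^ e + y ^ p ^ e := by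
    rw [← add_pow_char_pow, sub_add_cancel]
  rw [e1]
  exact add_mem (sup_pow p (fun x => pow_mem_fracSub _) (fun x => pow_mem_fracSub _) _ hwy)
    (Submodule.mem_sup_left hye)

omit [IsDomain A] in
theorem exists_eq_of_eval_mem {f : A[X]} (h0 : f.eval 0 ∈ maximalIdeal A)
    (h1 : f.eval 1 ∈ maximalIdeal A) :
    ∃ α ∈ maximalIdeal A, ∃ β ∈ maximalIdeal A, ∃ q, f = C α + C β * X + tPoly A * q := by
  have hdiv := modByMonic_add_div f (tPoly A)
  have hdeg : (f %ₘ tPoly A).degree ≤ 1 := by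
    have := degree_modByMonic_lt f (tPoly_monic (A := A))
    rw [degree_tPoly] at this
    exact Order.le_of_lt_succ this
  have hlin := eq_X_add_C_of_degree_le_one hdeg
  set β := (f %ₘ tPoly A).coeff 1
  set α := (f %ₘ tPoly A).coeff 0
  have hf : f = C α + C β * X + tPoly A * (f /ₘ tPoly A) := by
    rw [add_comm (C α), ← hlin, hdiv]
  have hα : f.eval 0 = α := by rw [hf]; simp [tPoly_eval_zero]
  have hβ : f.eval 1 = α + β := by rw [hf]; simp [tPoly_eval_one]
  rw [hα] at h0
  rw [hβ] at h1
  exact ⟨α, h0, β, by simpa using sub_mem h1 h0, _, hf⟩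

/-- If `c / a` is killed by the maximal ideal of `A` modulo `A`, then `c / (a (T (T - 1))^j)` is a
local section of `E ⧸ (tFrac + cFrac)`. The set of `y` of the form `s + c f / (a (T (T - 1))^j g)`,
with `s` in the sum, is moved by the maximal ideal of `R` to the corresponding set for `j - 1`. -/
theorem smul_mem_sup_of_socle (H : IsGluedLocalization A R E) {a c : A} (ha : a ≠ 0)
    (hc : ∀ b ∈ maximalIdeal A, a ∣ b * c) (j : ℕ) (r : R) (hr : r ∈ maximalIdeal R ^ j)
    (s y : E) (hs : s ∈ tFrac H ⊔ cFrac H) (f g : A[X]) (hg : g ∈ unitPoly A)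
    (hy : algebraMap A[X] E (C a * tPoly A ^ j * g) * (y - s) = algebraMap A[X] E (C c * f)) :
    r • y ∈ tFrac H ⊔ cFrac H := by
  induction j generalizing r s y f g with
  | zero =>
    refine Submodule.smul_mem _ _ ?_
    have : y - s ∈ cFrac H := ⟨C a * g, mem_cDenoms.2 ⟨a, ha, g, hg, rfl⟩, C c * f, by
      rw [← hy, pow_zero, mul_one]⟩
    have := add_mem (Submodule.mem_sup_right (S := tFrac H) this) hs
    rwa [sub_add_cancel] at this
  | succ j ih =>
    rw [pow_succ] at hr
    refine Submodule.mul_induction_on hr (fun r1 hr1 r2 hr2 => ?_) fun r1 r2 h1 h2 => by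
      rw [add_smul]; exact add_mem h1 h2
    obtain ⟨f0, hf0, g0, hg0, hu, h0, hm⟩ := H.exists_frac r2
    have hm := hm hr2
    obtain ⟨α, hα, β, hβ, q, hq⟩ := exists_eq_of_eval_mem hm ((eval_one_mem hf0).2 hm)
    obtain ⟨α', hα'⟩ := hc α hα
    obtain ⟨β', hβ'⟩ := hc β hβ
    have hg0' := mem_unitPoly_of_mem_glued hg0 hu
    have hd : tPoly A ^ (j + 1) * (g0 * g) ∈ tDenoms A :=
      mem_tDenoms.2 ⟨j + 1, g0 * g, mul_mem hg0' hg, rfl⟩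
    have hd0 : algebraMap A[X] E (tPoly A ^ (j + 1) * (g0 * g)) ≠ 0 := by
      rw [map_mul, map_pow]
      exact mul_ne_zero (pow_ne_zero _ algebraMap_tPoly_ne_zero)
        (algebraMap_unitPoly_ne_zero (mul_mem hg0' hg))
    -- `r2 = (α + β T + t q) / g0`; as `a` divides `α c` and `β c`, the first two terms multiply
    -- `c f / (a t ^ (j + 1) g)` to an element `z` of `tFrac`, and the third lowers the power
    -- of `t`.
    let z := algebraMap A[X] E ((C α' + C β' * X) * f) /
      algebraMap A[X] E (tPoly A ^ (j + 1) * (g0 * g))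
    have hz : algebraMap A[X] E (tPoly A ^ (j + 1) * (g0 * g)) * z =
      algebraMap A[X] E ((C α' + C β' * X) * f) := mul_div_cancel₀ _ hd0
    rw [mul_smul]
    refine ih r1 hr1 (r2 • s + z) _ (add_mem (Submodule.smul_mem _ _ hs)
      (Submodule.mem_sup_left ⟨_, hd, _, hz⟩)) (q * f) (g0 * g) (mul_mem hg0' hg) ?_
    apply mul_left_cancel₀ (algebraMap_tPoly_ne_zero (A := A) (E := E))
    have e1 := congrArg (algebraMap A[X] E) hq
    have e2 := congrArg (algebraMap A[X] E) (congrArg C hα')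
    have e3 := congrArg (algebraMap A[X] E) (congrArg C hβ')
    rw [Algebra.smul_def, Algebra.smul_def]
    simp only [map_mul, map_add, map_pow] at hy hz e1 e2 e3 h0 ⊢
    linear_combination algebraMap R E r2 * algebraMap A[X] E g0 * hy
      + algebraMap A[X] E (C c) * algebraMap A[X] E f * (h0 + e1)
      + algebraMap A[X] E f * (e2 + algebraMap A[X] E X * e3) - algebraMap A[X] E (C a) * hz

end

/-! ### The singularity classes of the glued ring -/

section

variable {A : Type u} [CommRing A] [IsLocalRing A] {R : Type u} [CommRing R]
  [IsLocalRing R] {E : Type u} [Field E] [Algebra A[X] E] [Algebra R E]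

omit [IsLocalRing A] [IsLocalRing R] in
theorem ne_zero_of_algebraMap_eq {r : R} {f : A[X]} (h : algebraMap R E r = algebraMap A[X] E f)
    (hf : algebraMap A[X] E f ≠ 0) : r ≠ 0 := by
  rintro rfl
  exact hf (by rw [← h, map_zero])

theorem mem_tFrac_of_smul (H : IsGluedLocalization A R E) {t : R}
    (ht : algebraMap R E t = algebraMap A[X] E (tPoly A)) (n : ℕ) {x : E}
    (hx : t ^ n • x ∈ tFrac H) : x ∈ tFrac H := by
  rw [Algebra.smul_def, map_pow, ht, ← map_pow] at hx
  exact mem_fracSub_of_mul (pow_mem tPoly_mem_tDenoms n) hx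

variable [IsDomain A]

theorem mem_cFrac_of_smul (H : IsGluedLocalization A R E) {a : A} (ha : a ≠ 0) {s : R}
    (hs : algebraMap R E s = algebraMap A[X] E (C a)) (n : ℕ) {x : E}
    (hx : s ^ n • x ∈ cFrac H) : x ∈ cFrac H := by
  rw [Algebra.smul_def, map_pow, hs, ← map_pow] at hx
  exact mem_fracSub_of_mul (pow_mem (C_mem_cDenoms ha) n) hx

variable [IsFractionRing A[X] E]

theorem algebraMap_X_mem (H : IsGluedLocalization A R E) :
    algebraMap A[X] E X ∈ tFrac H ⊓ cFrac H := by
  rw [tFrac_inf_cFrac]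
  exact ⟨1, one_mem _, X, by simp⟩

/-- The class of `T` in `E ⧸ R`. -/
def classX (H : IsGluedLocalization A R E) :
    powTorsion (maximalIdeal R) (E ⧸ baseImage R E) :=
  ⟨Submodule.Quotient.mk (algebraMap A[X] E X), mk_mem_powTorsion.2
    ⟨1, fun r hr => smul_mem_baseImage H (by simpa using hr) (algebraMap_X_mem H)⟩⟩

/-- The module of local sections of `E ⧸ R` is generated by the class of `T`. -/
theorem exists_smul_classX (H : IsGluedLocalization A R E) (hA : ¬ IsField A)
    (x : powTorsion (maximalIdeal R) (E ⧸ baseImage R E)) : ∃ r : R, r • classX H = x := by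
  obtain ⟨t, ht, ht'⟩ := H.exists_tPoly
  obtain ⟨a, ha, ha0⟩ := Submodule.exists_mem_ne_zero_of_ne_bot
    (mt isField_iff_maximalIdeal_eq.2 hA)
  obtain ⟨s, hs, hs'⟩ := H.exists_C ha
  obtain ⟨w, hw⟩ := Submodule.Quotient.mk_surjective _ x.1
  obtain ⟨n, hn⟩ := mk_mem_powTorsion.1 (hw ▸ x.2)
  have hmem : w ∈ tFrac H ⊓ cFrac H :=
    ⟨mem_tFrac_of_smul H ht' n (baseImage_le_fracSub H _ _ (hn _ (Ideal.pow_mem_pow ht n))),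
      mem_cFrac_of_smul H ha0 hs' n (baseImage_le_fracSub H _ _ (hn _ (Ideal.pow_mem_pow hs n)))⟩
  rw [tFrac_inf_cFrac] at hmem
  obtain ⟨g, hg, f, hf⟩ := hmem
  obtain ⟨g', hg', hu⟩ := exists_mul_mem_glued hg
  -- `g' f - α T` has equal values at `0` and `1`, so that `w = (g' f) / (g' g)` is
  -- `α / (g' g)` times `T` plus an element of `R`.
  set α := (g' * f).eval 1 - (g' * f).eval 0
  obtain ⟨r, hr, -⟩ := H.exists_eq (C α) (mem_glued.2 (by simp)) _ hg' hu
  obtain ⟨b, hb, -⟩ := H.exists_eq (g' * f - C α * X) (mem_glued.2 (by simp [α])) _ hg' hu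
  refine ⟨r, Subtype.ext ?_⟩
  rw [← hw]
  refine (Submodule.Quotient.eq _).2 ⟨-b, ?_⟩
  apply mul_left_cancel₀ (algebraMap_unitPoly_ne_zero (E := E) (mem_unitPoly_of_mem_glued hg' hu))
  change _ * algebraMap R E (-b) = _ * (r • algebraMap A[X] E X - w)
  rw [map_neg, Algebra.smul_def]
  simp only [map_mul, map_sub] at hr hb hf ⊢
  linear_combination - hb - algebraMap A[X] E X * hr + algebraMap A[X] E g' * hf

/-- `H^1_𝔪(R)` has finite length: it is generated by the class of `T`, which is killed by the
maximal ideal. -/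
theorem isFiniteLength_one (H : IsGluedLocalization A R E) (hA : ¬ IsField A)
    (hinj : Function.Injective (algebraMap R E)) : IsFiniteLength R (localCohomologyMax R 1) := by
  obtain ⟨t, ht, ht'⟩ := H.exists_tPoly
  have ht0 := ne_zero_of_algebraMap_eq ht' algebraMap_tPoly_ne_zero
  have : IsSimpleModule R (R ⧸ maximalIdeal R) :=
    isSimpleModule_iff_isCoatom.2 (Ideal.isMaximal_def.1 inferInstance)
  have hsimple : IsFiniteLength R (R ⧸ maximalIdeal R) :=
    isFiniteLength_iff_isNoetherian_isArtinian.2 ⟨inferInstance, inferInstance⟩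
  have hker : maximalIdeal R ≤ LinearMap.ker (LinearMap.toSpanSingleton R _ (classX H)) := by
    intro r hr
    rw [LinearMap.mem_ker, LinearMap.toSpanSingleton_apply]
    exact Subtype.ext ((Submodule.Quotient.mk_eq_zero _).2
      (smul_mem_baseImage H hr (algebraMap_X_mem H)))
  refine (hsimple.of_surjective (f := Submodule.liftQ _ _ hker) fun x => ?_).of_surjective
    (f := baseConnecting hinj 0 ∘ₗ ofPowTorsion (maximalIdeal R)
      (ModuleCat.of R (E ⧸ baseImage R E)))
    ((baseConnecting_surjective hinj ht ht0 0).comp (ofPowTorsion_bijective _ _).2)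
  obtain ⟨r, hr⟩ := exists_smul_classX H hA x
  exact ⟨Submodule.Quotient.mk r, hr⟩

omit [IsDomain A] in
theorem algebraMap_X_pow_notMem (H : IsGluedLocalization A R E) {n : ℕ} (hn : n ≠ 0) :
    algebraMap A[X] E X ^ n ∉ baseImage R E := by
  rintro ⟨r, hr⟩
  obtain ⟨f, hf, g, hg, hu, h, -⟩ := H.exists_frac r
  rw [Algebra.linearMap_apply] at hr
  rw [hr, ← map_pow, ← map_mul] at h
  obtain rfl := IsFractionRing.injective A[X] E h
  have h1 := (eval_one_mem hf).2 (by simp [hn])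
  rw [eval_mul, eval_pow, eval_X, one_pow, mul_one] at h1
  exact (mem_maximalIdeal _).1 ((eval_one_mem hg).1 h1) hu

variable (p : ℕ) [Fact p.Prime] [CharP R p] [CharP E p]

/-- The class of `T` in `H^1_𝔪(R)` is not `F`-nilpotent. -/
theorem frobeniusNilpotentPart_one_ne_top (H : IsGluedLocalization A R E)
    (hinj : Function.Injective (algebraMap R E)) : frobeniusNilpotentPart R p 1 ≠ ⊤ := by
  intro h
  obtain ⟨t, ht, ht'⟩ := H.exists_tPoly
  have ht0 := ne_zero_of_algebraMap_eq ht' algebraMap_tPoly_ne_zero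
  have hmem : baseConnecting hinj 0 (ofPowTorsion _ (ModuleCat.of R (E ⧸ baseImage R E))
      (classX H)) ∈ frobeniusNilpotentPart R p 1 := by rw [h]; exact Submodule.mem_top
  obtain ⟨e, he⟩ := Filter.Eventually.exists hmem
  exact algebraMap_X_pow_notMem H (pow_ne_zero e (Fact.out : p.Prime).ne_zero)
    ((frobeniusAction_degree_one_iff p hinj ht ht0 e _ _ rfl).1 he)

theorem not_isWeaklyFNilpotent (H : IsGluedLocalization A R E)
    (hinj : Function.Injective (algebraMap R E)) (hdim : 1 < ringKrullDim R) :
    ¬ IsWeaklyFNilpotent R p := fun h =>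
  frobeniusNilpotentPart_one_ne_top p H hinj (h 1 (by exact_mod_cast hdim))

theorem isGeneralizedWeaklyFNilpotent [CharP A p] (H : IsGluedLocalization A R E)
    (hinj : Function.Injective (algebraMap R E)) (hA : ¬ IsField A) (hdimA : 1 < ringKrullDim A)
    (hAp : IsWeaklyFNilpotent A p) (hdim : ringKrullDim R ≤ 3) :
    IsGeneralizedWeaklyFNilpotent R p := by
  obtain ⟨t, ht, ht'⟩ := H.exists_tPoly
  obtain ⟨a, ha, ha0⟩ := Submodule.exists_mem_ne_zero_of_ne_bot
    (mt isField_iff_maximalIdeal_eq.2 hA)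
  obtain ⟨s, hs, hs'⟩ := H.exists_C ha
  have ht0 := ne_zero_of_algebraMap_eq ht' algebraMap_tPoly_ne_zero
  have hs0 := ne_zero_of_algebraMap_eq hs' (algebraMap_C_ne_zero ha0)
  intro i hi
  have hi3 : i < 3 := by exact_mod_cast hi.trans_le hdim
  interval_cases i
  · have : Subsingleton (localCohomologyMax R 0) :=
      ⟨fun x y => by
        rw [localCohomologyMax_zero_eq_zero hinj ht ht0 x,
          localCohomologyMax_zero_eq_zero hinj ht ht0 y]⟩
    exact .of_subsingleton
  · exact (isFiniteLength_one H hA hinj).of_surjective (Submodule.mkQ_surjective _)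
  · rw [frobeniusNilpotentPart_two_eq_top p hinj (P := cFrac H) (Q := tFrac H) hs hs0
      (fun x hx => mem_cFrac_of_smul H ha0 hs' 1 (by rwa [pow_one])) ht ht0
      (fun x hx => mem_tFrac_of_smul H ht' 1 (by rwa [pow_one]))
      (le_inf (baseImage_le_fracSub H _ _) (baseImage_le_fracSub H _ _))
      (fun r hr x hx => smul_mem_baseImage H hr (by rwa [inf_comm]))
      (fun e x hx => pow_mem_fracSub _ hx) (fun e x hx => pow_mem_fracSub _ hx)]
    · have : Subsingleton (localCohomologyMax R 2 ⧸ (⊤ : Submodule R (localCohomologyMax R 2))) :=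
        Submodule.Quotient.subsingleton_iff.2 rfl
      exact .of_subsingleton
    · intro w hw
      rw [sup_comm] at hw ⊢
      exact eventually_pow_mem_sup H (p := p)
        (fun a c ha h => eventually_dvd_of_isWeaklyFNilpotent hdimA hAp ha h) w hw

omit [CharP R p] [CharP E p] [Fact p.Prime] in
/-- The fractions `c / (a (T (T - 1))^(j + 1))`, where `c / a` is a socle element modulo `A`, show
that `H^2_𝔪(R)` does not have finite length. -/
theorem not_isGeneralizedCohenMacaulay [IsNoetherianRing A] (H : IsGluedLocalization A R E)
    (hinj : Function.Injective (algebraMap R E)) (hA : ¬ IsField A) (hdepth : localDepth A ≤ 1)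
    (hdim : 2 < ringKrullDim R) : ¬ IsGeneralizedCohenMacaulay R := by
  obtain ⟨t, ht, ht'⟩ := H.exists_tPoly
  obtain ⟨a, ha, ha0, c, hac, hc⟩ := exists_socle_of_localDepth_le_one hA hdepth
  obtain ⟨s, hs, hs'⟩ := H.exists_C ha
  have hιt : algebraMap A[X] E (tPoly A) ≠ 0 := algebraMap_tPoly_ne_zero
  have hιa : algebraMap A[X] E (C a) ≠ 0 := algebraMap_C_ne_zero ha0
  have ht0 := ne_zero_of_algebraMap_eq ht' hιt
  have hs0 := ne_zero_of_algebraMap_eq hs' hιa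
  let w : ℕ → E := fun j => algebraMap A[X] E (C c) /
    (algebraMap A[X] E (C a) * algebraMap A[X] E (tPoly A) ^ (j + 1))
  have hw : ∀ j, algebraMap A[X] E (C a) * algebraMap A[X] E (tPoly A) ^ (j + 1) * w j =
      algebraMap A[X] E (C c) := fun j =>
    mul_div_cancel₀ _ (mul_ne_zero hιa (pow_ne_zero _ hιt))
  intro h
  refine not_isFiniteLength_two hinj (P := cFrac H) (Q := tFrac H) hs hs0
    (fun x hx => mem_cFrac_of_smul H ha0 hs' 1 (by rwa [pow_one])) ht ht0
    (fun x hx => mem_tFrac_of_smul H ht' 1 (by rwa [pow_one]))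
    (le_inf (baseImage_le_fracSub H _ _) (baseImage_le_fracSub H _ _))
    (fun r hr x hx => smul_mem_baseImage H hr (by rwa [inf_comm])) w
    (fun j => ⟨j + 1, fun r hr => ?_⟩) (fun j => ?_) ?_ (h 2 (by exact_mod_cast hdim))
  · rw [sup_comm]
    exact smul_mem_sup_of_socle H ha0 hc (j + 1) r hr 0 (w j) (zero_mem _) 1 1 (one_mem _)
      (by simpa using hw j)
  · have : t • w (j + 1) = w j := by
      apply mul_left_cancel₀ (mul_ne_zero hιa (pow_ne_zero (j + 1) hιt))
      rw [hw j, ← hw (j + 1), Algebra.smul_def, ht', pow_succ _ (j + 1)]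
      ring
    rw [this, sub_self]
    exact zero_mem _
  · intro h0
    rw [sup_comm] at h0
    refine hac ?_
    have hdvd := C_dvd_of_mem_sup H ha0 (N := 1) (h := C c) ?_ (by simpa using hw 0) h0
    · simpa using (C_dvd_iff_dvd_coeff _ _).1 hdvd 0
    rw [pow_one, degree_tPoly]
    exact degree_C_le.trans_lt (by norm_num)

end

/-! ### The conductor and the finiteness of `A[T]` over the glued ring -/

section Conductor

variable (A : Type u) [CommRing A] [IsLocalRing A]

variable {A} in
theorem mem_gluedConductor {f : gluedSubalgebra A} :
    f ∈ gluedConductor A ↔ (f : A[X]).eval 0 ∈ maximalIdeal A := by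
  rw [gluedConductor, Module.mem_annihilator]
  constructor
  · intro h
    have hX := h (Submodule.Quotient.mk X)
    rw [← Submodule.Quotient.mk_smul, Submodule.Quotient.mk_eq_zero] at hX
    obtain ⟨⟨g, hg⟩, hgX⟩ := hX
    have hgX : g = (f : A[X]) * X := hgX
    rw [hgX] at hg
    exact (eval_one_mem f.2).1 (by simpa using (eval_one_mem hg).2 (by simp))
  · intro h x
    obtain ⟨x, rfl⟩ := Submodule.Quotient.mk_surjective _ x
    rw [← Submodule.Quotient.mk_smul, Submodule.Quotient.mk_eq_zero]
    refine ⟨⟨(f : A[X]) * x, mem_glued_of_eval_mem ?_ ?_⟩, rfl⟩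
    · rw [eval_mul]; exact Ideal.mul_mem_right _ _ h
    · rw [eval_mul]; exact Ideal.mul_mem_right _ _ ((eval_one_mem f.2).2 h)

variable {A} in
theorem mem_originIdeal {f : A[X]} : f ∈ originIdeal A ↔ f.eval 0 ∈ maximalIdeal A := by
  rw [originIdeal_eq_ker]
  simp [RingHom.mem_ker, evalResidue]

theorem comap_originIdeal :
    (originIdeal A).comap (algebraMap (gluedSubalgebra A) A[X]) = gluedConductor A := by
  ext f
  rw [mem_gluedConductor]
  exact mem_originIdeal

instance gluedConductor_isMaximal : (gluedConductor A).IsMaximal := by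
  have h : gluedConductor A =
      RingHom.ker ((evalResidue A 0).comp (gluedSubalgebra A).val.toRingHom) := by
    ext f
    rw [mem_gluedConductor]
    simp [RingHom.mem_ker, evalResidue]
  rw [h]
  refine RingHom.ker_isMaximal_of_surjective _ fun x => ?_
  obtain ⟨a, rfl⟩ := residue_surjective x
  exact ⟨⟨C a, mem_glued.2 (by simp)⟩, by simp [evalResidue]⟩

instance originIdeal_isMaximal : (originIdeal A).IsMaximal := by
  rw [originIdeal_eq_ker]
  refine RingHom.ker_isMaximal_of_surjective _ fun x => ?_
  obtain ⟨a, rfl⟩ := residue_surjective x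
  exact ⟨C a, by simp [evalResidue]⟩

/-- `A[T]` is generated by `1` and `T` as a module over the glued ring. -/
instance finite_gluedSubalgebra : Module.Finite (gluedSubalgebra A) A[X] := by
  refine Module.finite_def.2 (Submodule.fg_def.2
    ⟨{1, X}, Set.toFinite _, eq_top_iff.2 fun f _ => ?_⟩)
  rw [Submodule.mem_span_pair]
  refine ⟨⟨f - C (f.eval 1 - f.eval 0) * X, mem_glued.2 (by simp)⟩,
    ⟨C (f.eval 1 - f.eval 0), mem_glued.2 (by simp)⟩, ?_⟩
  rw [Algebra.smul_def, Algebra.smul_def]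
  change (f - C (f.eval 1 - f.eval 0) * X) * 1 + C (f.eval 1 - f.eval 0) * X = f
  ring

theorem isNoetherianRing_gluedSubalgebra [IsNoetherianRing A] :
    IsNoetherianRing (gluedSubalgebra A) := by
  have : Algebra.FiniteType A (gluedSubalgebra A) :=
    ⟨fg_of_fg_of_fg A (gluedSubalgebra A) A[X] Algebra.FiniteType.out Module.Finite.fg_top
      Subtype.val_injective⟩
  exact Algebra.FiniteType.isNoetherianRing A _

/-! ### The dimension -/

theorem ringKrullDim_gluedSubalgebra_le :
    ringKrullDim (gluedSubalgebra A) ≤ ringKrullDim A[X] := by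
  refine iSup_le fun l => ?_
  obtain ⟨P, -, hP, hP'⟩ := Ideal.exists_ideal_over_prime_of_isIntegral (S := A[X])
    l.head.asIdeal ⊥ (by
      rw [← RingHom.ker_eq_comap_bot, (RingHom.injective_iff_ker_eq_bot _).1
        (show Function.Injective (algebraMap (gluedSubalgebra A) A[X]) from
          Subtype.val_injective)]
      exact bot_le)
  have : P.LiesOver l.head.asIdeal := ⟨hP'.symm⟩
  obtain ⟨L, hL, -⟩ := Ideal.exists_ltSeries_of_hasGoingUp (S := A[X]) l P
  exact hL ▸ le_iSup (fun L : LTSeries (PrimeSpectrum A[X]) => (L.length : WithBot ℕ∞)) L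

/-- By incomparability, chains of primes below the origin contract to chains of primes below the
conductor. -/
theorem height_originIdeal_le : (originIdeal A).height ≤ (gluedConductor A).height := by
  have hmono : StrictMono (PrimeSpectrum.comap (algebraMap (gluedSubalgebra A) A[X])) :=
    fun P Q h => Ideal.IsIntegral.comap_lt_comap (I := P.asIdeal) (J := Q.asIdeal) h
  have := Order.height_le_height_apply_of_strictMono _ hmono ⟨originIdeal A, inferInstance⟩
  have e : PrimeSpectrum.comap (algebraMap (gluedSubalgebra A) A[X])
      ⟨originIdeal A, inferInstance⟩ = ⟨gluedConductor A, inferInstance⟩ :=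
    PrimeSpectrum.ext (comap_originIdeal A)
  rw [e, ← PrimeSpectrum.height_eq_orderHeight, ← PrimeSpectrum.height_eq_orderHeight] at this
  exact this

theorem height_originIdeal [IsNoetherianRing A] :
    (originIdeal A).height = (maximalIdeal A).height + 1 := by
  have : (originIdeal A).LiesOver (maximalIdeal A) := ⟨by
    ext a
    rw [Ideal.under, Ideal.mem_comap, mem_originIdeal]
    simp⟩
  exact Polynomial.height_eq_height_add_one _ _

theorem ringKrullDim_localization [IsNoetherianRing A] :
    ringKrullDim (Localization.AtPrime (gluedConductor A)) = ringKrullDim A + 1 := by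
  rw [IsLocalization.AtPrime.ringKrullDim_eq_height (gluedConductor A)
    (Localization.AtPrime (gluedConductor A))]
  apply le_antisymm
  · refine (Ideal.height_le_ringKrullDim_of_ne_top Ideal.IsPrime.ne_top').trans ?_
    exact (ringKrullDim_gluedSubalgebra_le A).trans (ringKrullDim_of_isNoetherianRing).le
  · rw [← maximalIdeal_height_eq_ringKrullDim]
    have := height_originIdeal_le A
    rw [height_originIdeal] at this
    exact_mod_cast this

end Conductor

/-! ### The localization at the conductor -/

section Localization

variable (A : Type u) [CommRing A] [IsLocalRing A]

variable {A} in
theorem isUnit_eval_of_mem_primeCompl {g : gluedSubalgebra A}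
    (hg : g ∈ (gluedConductor A).primeCompl) : IsUnit ((g : A[X]).eval 0) := by
  by_contra h
  exact hg (mem_gluedConductor.2 ((mem_maximalIdeal _).2 h))

variable {A} in
theorem mem_primeCompl_of_isUnit_eval {g : gluedSubalgebra A}
    (hg : IsUnit ((g : A[X]).eval 0)) : g ∈ (gluedConductor A).primeCompl := fun h =>
  (mem_maximalIdeal _).1 (mem_gluedConductor.1 h) hg

variable [IsDomain A]

theorem isUnit_algebraMap_fractionRing (g : (gluedConductor A).primeCompl) :
    IsUnit (((algebraMap A[X] (FractionRing A[X])).comp (gluedSubalgebra A).val.toRingHom) g) := by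
  refine isUnit_iff_ne_zero.2 ((map_ne_zero_iff _ (IsFractionRing.injective A[X] _)).2 fun h => ?_)
  refine g.2 (mem_gluedConductor.2 ?_)
  have h : ((g : gluedSubalgebra A) : A[X]) = 0 := h
  simp [h]

/-- The inclusion of the localization at the conductor into the fraction field of `A[T]`. -/
def toFractionRing : Localization.AtPrime (gluedConductor A) →+* FractionRing A[X] :=
  IsLocalization.lift (isUnit_algebraMap_fractionRing A)

variable {A} in
theorem toFractionRing_algebraMap (f : gluedSubalgebra A) :
    toFractionRing A (algebraMap _ _ f) = algebraMap A[X] (FractionRing A[X]) f :=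
  IsLocalization.lift_eq _ f

theorem algebraMap_localization_injective : Function.Injective
    (algebraMap (gluedSubalgebra A) (Localization.AtPrime (gluedConductor A))) :=
  IsLocalization.injective (Localization.AtPrime (gluedConductor A))
    (gluedConductor A).primeCompl_le_nonZeroDivisors

theorem toFractionRing_injective : Function.Injective (toFractionRing A) :=
  (IsLocalization.lift_injective_iff _).2 fun x y => by
    rw [(algebraMap_localization_injective A).eq_iff]
    exact ((IsFractionRing.injective A[X] (FractionRing A[X])).comp
      (Subtype.val_injective)).eq_iff.symm

variable {A} in
theorem mul_toFractionRing_mk' (f : gluedSubalgebra A) (g : (gluedConductor A).primeCompl) :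
    algebraMap A[X] (FractionRing A[X]) (g : gluedSubalgebra A) *
      toFractionRing A (IsLocalization.mk' _ f g) = algebraMap A[X] (FractionRing A[X]) f := by
  rw [← toFractionRing_algebraMap, ← toFractionRing_algebraMap, ← map_mul,
    IsLocalization.mk'_spec']

omit [IsDomain A] in
variable {A} in
theorem mk'_mem_maximalIdeal_iff (f : gluedSubalgebra A) (g : (gluedConductor A).primeCompl) :
    IsLocalization.mk' (Localization.AtPrime (gluedConductor A)) f g ∈
      maximalIdeal (Localization.AtPrime (gluedConductor A)) ↔
        (f : A[X]).eval 0 ∈ maximalIdeal A :=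
  (IsLocalization.AtPrime.mk'_mem_maximal_iff (Localization.AtPrime (gluedConductor A))
    (gluedConductor A) f g).trans mem_gluedConductor

theorem isGluedLocalization :
    let _ := (toFractionRing A).toAlgebra
    IsGluedLocalization A (Localization.AtPrime (gluedConductor A)) (FractionRing A[X]) := by
  let _ := (toFractionRing A).toAlgebra
  refine IsGluedLocalization.mk (fun r => ?_) fun f hf g hg hu => ?_
  · obtain ⟨f, g, rfl⟩ := IsLocalization.exists_mk'_eq (gluedConductor A).primeCompl r
    exact ⟨f.1, f.2, g.1.1, g.1.2, isUnit_eval_of_mem_primeCompl g.2,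
      mul_toFractionRing_mk' f g, (mk'_mem_maximalIdeal_iff f g).1⟩
  · let f' : gluedSubalgebra A := ⟨f, hf⟩
    let g' : (gluedConductor A).primeCompl := ⟨⟨g, hg⟩, mem_primeCompl_of_isUnit_eval hu⟩
    let r := IsLocalization.mk' (Localization.AtPrime (gluedConductor A)) f' g'
    exact ⟨r, mul_toFractionRing_mk' f' g', (mk'_mem_maximalIdeal_iff f' g').2⟩

theorem algebraMap_base_injective :
    Function.Injective (algebraMap A (Localization.AtPrime (gluedConductor A))) := by
  rw [IsScalarTower.algebraMap_eq A (gluedSubalgebra A)]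
  exact (algebraMap_localization_injective A).comp fun a b h =>
    C_injective (congrArg Subtype.val h)

omit [IsDomain A] in
theorem isLocalHom_algebraMap_base :
    IsLocalHom (algebraMap A (Localization.AtPrime (gluedConductor A))) := by
  refine ⟨fun a ha => ?_⟩
  rw [IsScalarTower.algebraMap_apply A (gluedSubalgebra A),
    IsLocalization.AtPrime.isUnit_to_map_iff _ (gluedConductor A)] at ha
  have := isUnit_eval_of_mem_primeCompl ha
  simpa using this

omit [IsDomain A] in
theorem isUnit_algebraMap_origin (g : (gluedConductor A).primeCompl) :
    IsUnit (Algebra.ofId (gluedSubalgebra A) (Localization.AtPrime (originIdeal A)) g) := by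
  have : IsUnit (algebraMap A[X] (Localization.AtPrime (originIdeal A)) (g : gluedSubalgebra A)) :=
    (IsLocalization.AtPrime.isUnit_to_map_iff _ (originIdeal A) _).2 fun h =>
      g.2 (mem_gluedConductor.2 (mem_originIdeal.1 h))
  exact this

/-- The inclusion of the localization at the conductor into `A[T]` localized at the origin of the
closed fibre. -/
def toOrigin : Localization.AtPrime (gluedConductor A) →ₐ[gluedSubalgebra A]
    Localization.AtPrime (originIdeal A) :=
  IsLocalization.liftAlgHom (M := (gluedConductor A).primeCompl) (isUnit_algebraMap_origin A)

theorem toOrigin_injective : Function.Injective (toOrigin A) :=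
  (IsLocalization.lift_injective_iff _).2 fun x y => by
    rw [(algebraMap_localization_injective A).eq_iff]
    exact ((IsLocalization.injective (Localization.AtPrime (originIdeal A))
      (originIdeal A).primeCompl_le_nonZeroDivisors).comp Subtype.val_injective).eq_iff.symm

omit [IsDomain A] in
theorem isLocalHom_toOrigin : IsLocalHom (toOrigin A).toRingHom := by
  refine ⟨fun r hr => ?_⟩
  obtain ⟨f, g, rfl⟩ := IsLocalization.exists_mk'_eq (gluedConductor A).primeCompl r
  rw [IsLocalization.AtPrime.isUnit_mk'_iff _ (gluedConductor A)]
  intro hf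
  have h : IsUnit (toOrigin A (algebraMap _ _ f)) := by
    rw [← IsLocalization.mk'_spec' (M := (gluedConductor A).primeCompl) _ f g, map_mul]
    refine IsUnit.mul ?_ hr
    rw [AlgHom.commutes]
    exact isUnit_algebraMap_origin A g
  rw [AlgHom.commutes] at h
  exact (IsLocalization.AtPrime.isUnit_to_map_iff (Localization.AtPrime (originIdeal A))
    (originIdeal A) (f : A[X])).1 h (mem_originIdeal.2 (mem_gluedConductor.1 hf))

end Localization

end GluedPoints

end

theorem mainTheorem9
    (p : ℕ) [Fact p.Prime]
    (K : Type*) [Field K] [CharP K p] [PerfectField K]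
    (A : Type*) [CommRing A] [IsDomain A] [IsLocalRing A] [CharP A p]
    [Algebra K A] [Algebra.EssFiniteType K A]
    (hdim : ringKrullDim A = 2) (hdepth : localDepth A = 1)
    (hA : IsWeaklyFNilpotent A p) :
    ∃ _ : (gluedConductor A).IsMaximal,
      -- the local inclusions `(A, 𝔪) ⊆ (R, 𝔠) ⊆ (B, 𝔫)`, where `R = R'_𝔠` and `B = A[T]_𝔫`
      (Function.Injective (algebraMap A (Localization.AtPrime (gluedConductor A))) ∧
        IsLocalHom (algebraMap A (Localization.AtPrime (gluedConductor A)))) ∧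
      (∃ φ : Localization.AtPrime (gluedConductor A) →ₐ[gluedSubalgebra A]
          Localization.AtPrime (originIdeal A),
        Function.Injective φ ∧ IsLocalHom φ.toRingHom) ∧
      IsNoetherianRing (Localization.AtPrime (gluedConductor A)) ∧
      IsGeneralizedWeaklyFNilpotent (Localization.AtPrime (gluedConductor A)) p ∧
      ¬ IsGeneralizedCohenMacaulay (Localization.AtPrime (gluedConductor A)) ∧
      ¬ IsWeaklyFNilpotent (Localization.AtPrime (gluedConductor A)) p := by
  have : IsNoetherianRing A := Algebra.EssFiniteType.isNoetherianRing K A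
  have hN := GluedPoints.isNoetherianRing_gluedSubalgebra A
  have hfield : ¬ IsField A := fun h => by
    rw [ringKrullDim_eq_zero_of_isField h] at hdim
    exact absurd hdim (by norm_num)
  have hdimR : ringKrullDim (Localization.AtPrime (gluedConductor A)) = 3 := by
    rw [GluedPoints.ringKrullDim_localization, hdim]
    norm_num
  let _ := (GluedPoints.toFractionRing A).toAlgebra
  have hinj : Function.Injective
      (algebraMap (Localization.AtPrime (gluedConductor A)) (FractionRing A[X])) :=
    GluedPoints.toFractionRing_injective A
  have hE : CharP (FractionRing A[X]) p :=
    charP_of_injective_algebraMap (IsFractionRing.injective A[X] (FractionRing A[X])) p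
  have H := GluedPoints.isGluedLocalization A
  refine ⟨inferInstance, ⟨GluedPoints.algebraMap_base_injective A,
    GluedPoints.isLocalHom_algebraMap_base A⟩, ⟨GluedPoints.toOrigin A,
    GluedPoints.toOrigin_injective A, GluedPoints.isLocalHom_toOrigin A⟩,
    IsLocalization.isNoetherianRing (gluedConductor A).primeCompl _ hN, ?_, ?_, ?_⟩
  · exact GluedPoints.isGeneralizedWeaklyFNilpotent p H hinj hfield (by rw [hdim]; norm_num) hA
      hdimR.le
  · exact GluedPoints.not_isGeneralizedCohenMacaulay H hinj hfield hdepth.le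
      (by rw [hdimR]; norm_num)
  · exact GluedPoints.not_isWeaklyFNilpotent p H hinj (by rw [hdimR]; norm_num)
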